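/- Let $p,q\ge 3$ be integers. Let $\mathrm{UDC}_{p,q}$ be the set of ultramodular bivariate discrete copulas on $\{0,\frac1p,\dots,1\}\times\{0,\frac1q,\dots,1\}$, that is, of all matrices $[c_{ij}]_{0\le i\le p,\,0\le j\le q}\in\mathbb{R}^{(p+1)\times(q+1)}$ such that (c1) $c_{0j}=0$, $c_{pj}=\frac jq$, $c_{i0}=0$, $c_{iq}=\frac ip$ for all $0\le i\le p$, $0\le j\le q$; (c2) $c_{ij}+c_{i-1,j-1}-c_{i,j-1}-c_{i-1,j}\ge 0$ for all $1\le i\le p$, $1\le j\le q$; (c3) $2c_{ij}\le c_{i-1,j}+c_{i+1,j}$ and $2c_{ij}\le c_{i,j-1}+c_{i,j+1}$ for all $1\le i\le p-1$, $1\le j\le q-1$. An H-representation of a set $P$ is a finite system of affine equations and affine inequalities whose solution set is $P$. It is minimal if deleting any one of its inequalities strictly enlarges the solution set and no H-representation of $P$ (with any equations) has fewer inequalities. Then the equations (c1) together with the following inequalities form a minimal H-representation of $\mathrm{UDC}_{p,q}$: (d1) $x_{11}\ge 0$ and $x_{p-1,q-1}\ge\frac{(p-1)(q-1)-1}{pq}$;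 (d2) $x_{ij}+x_{i+1,j+1}-x_{i,j+1}-x_{i+1,j}\ge 0$ for all $1\le i\le p-2$, $1\le j\le q-2$ with $(i,j)\notin\{(1,1),(p-2,q-2)\}$; (d3a) $x_{ij}+x_{i,j+2}-2x_{i,j+1}\ge 0$ for all $1\le i\le p-1$, $0\le j\le q-2$; (d3b) $x_{ij}+x_{i+2,j}-2x_{i+1,j}\ge 0$ for all $1\le j\le q-1$, $0\le i\le p-2$. Equivalently, let $T:\mathbb{R}^{(p+1)\times(q+1)}\to\mathbb{R}^{p\times q}$, $T(c)_{ij}=c_{ij}+c_{i-1,j-1}-c_{i,j-1}-c_{i-1,j}$. The image $pq\,T(\mathrm{UDC}_{p,q})$ is contained in the generalized Birkhoff polytope $\mathcal{B}_{p,q}$ of nonnegative $p\times q$ matrices with all row sums $q$ and all column sums $p$, and a minimal H-representation of it is given by these row and column sum equations together with the inequalities (b1) $x_{11}\ge 0$ and $x_{pq}\ge 0$; (b2) $x_{i+1,j+1}\ge 0$ for all $1\le i\le p-2$, $1\le j\le q-2$ with $(i,j)\notin\{(1,1),(p-2,q-2)\}$; (b3a) $\sum_{\ell=1}^i x_{\ell,j+1}\ge\sum_{\ell=1}^i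 x_{\ell j}$ for all $1\le i\le p-1$, $1\le j\le q-1$; (b3b) $\sum_{h=1}^j x_{i+1,h}\ge\sum_{h=1}^j x_{ih}$ for all $1\le i\le p-1$, $1\le j\le q-1$. If $(p,q)\ne(3,3)$, each of the two lists (d1)–(d3b) and (b1)–(b3b) consists of exactly $(p-2)(q-2)+2(p-1)(q-1)$ distinct inequalities; if $p=q=3$, each consists of exactly $10$. -/

import Mathlib

/-! ### H-representations -/

/-- The solution set of a system of affine equations `f x = 0` and affine inequalities `0 ≤ f x`. -/
def polyhedron {E : Type*} [AddCommGroup E] [Module ℝ E]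
    (eqs ineqs : Set (E →ᵃ[ℝ] ℝ)) : Set E :=
  {x | (∀ f ∈ eqs, f x = 0) ∧ ∀ f ∈ ineqs, 0 ≤ f x}

/-- An H-representation of `P`: finitely many affine equations and affine inequalities
whose set of common solutions is `P`. -/
structure IsHRepresentation {E : Type*} [AddCommGroup E] [Module ℝ E]
    (P : Set E) (eqs ineqs : Set (E →ᵃ[ℝ] ℝ)) : Prop where
  finite_eqs : eqs.Finite
  finite_ineqs : ineqs.Finite
  eq_polyhedron : P = polyhedron eqs ineqs

/-- A minimal H-representation of `P`: dropping any one of the inequalities strictly enlarges the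
solution set, and no H-representation of `P` (with whatever equations) has fewer inequalities. -/
structure IsMinimalHRepresentation {E : Type*} [AddCommGroup E] [Module ℝ E]
    (P : Set E) (eqs ineqs : Set (E →ᵃ[ℝ] ℝ)) : Prop
    extends IsHRepresentation P eqs ineqs where
  irredundant : ∀ f ∈ ineqs, P ⊂ polyhedron eqs (ineqs \ {f})
  card_le : ∀ eqs' ineqs' : Set (E →ᵃ[ℝ] ℝ),
    IsHRepresentation P eqs' ineqs' → ineqs.ncard ≤ ineqs'.ncard

/-! ### Discrete copulas on the grid `I_p × I_q` -/

/-- The coordinate function `c ↦ c_{ij}`, for `0 ≤ i ≤ p` and `0 ≤ j ≤ q`, on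
`(p+1) × (q+1)` matrices with rows and columns numbered from `0` (and `0` out of range). -/
def gridEntry (p q i j : ℕ) : Matrix (Fin (p + 1)) (Fin (q + 1)) ℝ →ᵃ[ℝ] ℝ :=
  if h : i < p + 1 ∧ j < q + 1 then
    (Matrix.entryLinearMap ℝ ℝ (⟨i, h.1⟩ : Fin (p + 1)) (⟨j, h.2⟩ : Fin (q + 1))).toAffineMap
  else 0

/-- The bivariate discrete copulas on `I_p × I_q`, as `(p+1) × (q+1)` matrices. -/
def discreteCopulas (p q : ℕ) : Set (Matrix (Fin (p + 1)) (Fin (q + 1)) ℝ) :=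
  {c | (∀ j ≤ q, gridEntry p q 0 j c = 0 ∧ gridEntry p q p j c = (j : ℝ) / q) ∧
    (∀ i ≤ p, gridEntry p q i 0 c = 0 ∧ gridEntry p q i q c = (i : ℝ) / p) ∧
    ∀ i ∈ Finset.Icc 1 p, ∀ j ∈ Finset.Icc 1 q,
      0 ≤ gridEntry p q i j c + gridEntry p q (i - 1) (j - 1) c
        - gridEntry p q i (j - 1) c - gridEntry p q (i - 1) j c}

/-- The ultramodular bivariate discrete copulas on `I_p × I_q`. -/
def ultramodularDiscreteCopulas (p q : ℕ) : Set (Matrix (Fin (p + 1)) (Fin (q + 1)) ℝ) :=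
  {c | c ∈ discreteCopulas p q ∧
    ∀ i ∈ Finset.Icc 1 (p - 1), ∀ j ∈ Finset.Icc 1 (q - 1),
      2 * gridEntry p q i j c ≤ gridEntry p q (i - 1) j c + gridEntry p q (i + 1) j c ∧
      2 * gridEntry p q i j c ≤ gridEntry p q i (j - 1) c + gridEntry p q i (j + 1) c}

/-- The boundary equations `c_{0j} = 0`, `c_{pj} = j/q`, `c_{i0} = 0`, `c_{iq} = i/p`. -/
def boundaryEqs (p q : ℕ) : Set (Matrix (Fin (p + 1)) (Fin (q + 1)) ℝ →ᵃ[ℝ] ℝ) :=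
  {f | ∃ j ≤ q, f = gridEntry p q 0 j} ∪
  {f | ∃ j ≤ q, f = gridEntry p q p j - AffineMap.const ℝ _ ((j : ℝ) / q)} ∪
  {f | ∃ i ≤ p, f = gridEntry p q i 0} ∪
  {f | ∃ i ≤ p, f = gridEntry p q i q - AffineMap.const ℝ _ ((i : ℝ) / p)}

/-- `x_{11} ≥ 0` and `x_{p-1,q-1} ≥ ((p-1)(q-1)-1)/(pq)`. -/
def cornerIneqs (p q : ℕ) : Set (Matrix (Fin (p + 1)) (Fin (q + 1)) ℝ →ᵃ[ℝ] ℝ) :=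
  {gridEntry p q 1 1,
    gridEntry p q (p - 1) (q - 1)
      - AffineMap.const ℝ _ ((((p : ℝ) - 1) * ((q : ℝ) - 1) - 1) / ((p : ℝ) * q))}

/-- `x_{ij} + x_{i+1,j+1} - x_{i,j+1} - x_{i+1,j} ≥ 0` for `1 ≤ i ≤ p-2`, `1 ≤ j ≤ q-2`,
`(i,j)` different from `(1,1)` and `(p-2,q-2)`. -/
def supermodularIneqs (p q : ℕ) : Set (Matrix (Fin (p + 1)) (Fin (q + 1)) ℝ →ᵃ[ℝ] ℝ) :=
  {f | ∃ i ∈ Finset.Icc 1 (p - 2), ∃ j ∈ Finset.Icc 1 (q - 2),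
    (i, j) ≠ (1, 1) ∧ (i, j) ≠ (p - 2, q - 2) ∧
    f = gridEntry p q i j + gridEntry p q (i + 1) (j + 1)
      - gridEntry p q i (j + 1) - gridEntry p q (i + 1) j}

/-- `x_{ij} + x_{i,j+2} - 2 x_{i,j+1} ≥ 0` for `1 ≤ i ≤ p-1`, `0 ≤ j ≤ q-2`. -/
def rowConvexityIneqs (p q : ℕ) : Set (Matrix (Fin (p + 1)) (Fin (q + 1)) ℝ →ᵃ[ℝ] ℝ) :=
  {f | ∃ i ∈ Finset.Icc 1 (p - 1), ∃ j ∈ Finset.Icc 0 (q - 2),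
    f = gridEntry p q i j + gridEntry p q i (j + 2) - (2 : ℝ) • gridEntry p q i (j + 1)}

/-- `x_{ij} + x_{i+2,j} - 2 x_{i+1,j} ≥ 0` for `1 ≤ j ≤ q-1`, `0 ≤ i ≤ p-2`. -/
def columnConvexityIneqs (p q : ℕ) : Set (Matrix (Fin (p + 1)) (Fin (q + 1)) ℝ →ᵃ[ℝ] ℝ) :=
  {f | ∃ j ∈ Finset.Icc 1 (q - 1), ∃ i ∈ Finset.Icc 0 (p - 2),
    f = gridEntry p q i j + gridEntry p q (i + 2) j - (2 : ℝ) • gridEntry p q (i + 1) j}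

/-- All the inequalities describing the ultramodular discrete copulas. -/
def ultramodularIneqs (p q : ℕ) : Set (Matrix (Fin (p + 1)) (Fin (q + 1)) ℝ →ᵃ[ℝ] ℝ) :=
  cornerIneqs p q ∪ supermodularIneqs p q ∪ rowConvexityIneqs p q ∪ columnConvexityIneqs p q

/-! ### The generalized Birkhoff polytope -/

/-- The transportation polytope with margins `u` and `v`. -/
def transportationPolytope {p q : ℕ} (u : Fin p → ℝ) (v : Fin q → ℝ) :
    Set (Matrix (Fin p) (Fin q) ℝ) :=
  {x | (∀ i j, 0 ≤ x i j) ∧ (∀ i, ∑ h, x i h = u i) ∧ ∀ j, ∑ l, x l j = v j}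

/-- The `p × q` generalized Birkhoff polytope: all row sums are `q`, all column sums are `p`. -/
def generalizedBirkhoff (p q : ℕ) : Set (Matrix (Fin p) (Fin q) ℝ) :=
  transportationPolytope (fun _ => (q : ℝ)) (fun _ => (p : ℝ))

/-- The linear map `T`, `T(c)_{ij} = c_{ij} + c_{i-1,j-1} - c_{i,j-1} - c_{i-1,j}` for
`1 ≤ i ≤ p`, `1 ≤ j ≤ q`; row `i` of the image has index `i - 1` in `Fin p`,
and column `j` has index `j - 1` in `Fin q`. -/
def massMatrix {p q : ℕ} (c : Matrix (Fin (p + 1)) (Fin (q + 1)) ℝ) : Matrix (Fin p) (Fin q) ℝ :=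
  Matrix.of fun i j =>
    c i.succ j.succ + c i.castSucc j.castSucc - c i.succ j.castSucc - c i.castSucc j.succ

/-- The image `pq · T(UDC_{p,q})` of the ultramodular discrete copulas. -/
def ultramodularBirkhoff (p q : ℕ) : Set (Matrix (Fin p) (Fin q) ℝ) :=
  (fun c => ((p : ℝ) * q) • massMatrix c) '' ultramodularDiscreteCopulas p q

/-- The coordinate function `x ↦ x_{ij}`, for `1 ≤ i ≤ p` and `1 ≤ j ≤ q`, on `p × q` matrices
with rows and columns numbered from `1` (and `0` out of range). -/
def massEntry (p q i j : ℕ) : Matrix (Fin p) (Fin q) ℝ →ᵃ[ℝ] ℝ :=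
  if h : (1 ≤ i ∧ i - 1 < p) ∧ (1 ≤ j ∧ j - 1 < q) then
    (Matrix.entryLinearMap ℝ ℝ (⟨i - 1, h.1.2⟩ : Fin p) (⟨j - 1, h.2.2⟩ : Fin q)).toAffineMap
  else 0

/-- The margin equations: every row sum is `q`, every column sum is `p`. -/
def marginEqs (p q : ℕ) : Set (Matrix (Fin p) (Fin q) ℝ →ᵃ[ℝ] ℝ) :=
  {f | ∃ i ∈ Finset.Icc 1 p,
    f = ∑ h ∈ Finset.Icc 1 q, massEntry p q i h - AffineMap.const ℝ _ (q : ℝ)} ∪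
  {f | ∃ j ∈ Finset.Icc 1 q,
    f = ∑ l ∈ Finset.Icc 1 p, massEntry p q l j - AffineMap.const ℝ _ (p : ℝ)}

/-- `x_{11} ≥ 0` and `x_{pq} ≥ 0`. -/
def massCornerIneqs (p q : ℕ) : Set (Matrix (Fin p) (Fin q) ℝ →ᵃ[ℝ] ℝ) :=
  {massEntry p q 1 1, massEntry p q p q}

/-- `x_{i+1,j+1} ≥ 0` for `1 ≤ i ≤ p-2`, `1 ≤ j ≤ q-2`,
`(i,j)` different from `(1,1)` and `(p-2,q-2)`. -/
def massInteriorIneqs (p q : ℕ) : Set (Matrix (Fin p) (Fin q) ℝ →ᵃ[ℝ] ℝ) :=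
  {f | ∃ i ∈ Finset.Icc 1 (p - 2), ∃ j ∈ Finset.Icc 1 (q - 2),
    (i, j) ≠ (1, 1) ∧ (i, j) ≠ (p - 2, q - 2) ∧ f = massEntry p q (i + 1) (j + 1)}

/-- `∑_{l ≤ i} x_{l,j+1} ≥ ∑_{l ≤ i} x_{lj}` for `1 ≤ i ≤ p-1`, `1 ≤ j ≤ q-1`. -/
def massColumnSumIneqs (p q : ℕ) : Set (Matrix (Fin p) (Fin q) ℝ →ᵃ[ℝ] ℝ) :=
  {f | ∃ i ∈ Finset.Icc 1 (p - 1), ∃ j ∈ Finset.Icc 1 (q - 1),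
    f = ∑ l ∈ Finset.Icc 1 i, massEntry p q l (j + 1) - ∑ l ∈ Finset.Icc 1 i, massEntry p q l j}

/-- `∑_{h ≤ j} x_{i+1,h} ≥ ∑_{h ≤ j} x_{ih}` for `1 ≤ i ≤ p-1`, `1 ≤ j ≤ q-1`. -/
def massRowSumIneqs (p q : ℕ) : Set (Matrix (Fin p) (Fin q) ℝ →ᵃ[ℝ] ℝ) :=
  {f | ∃ i ∈ Finset.Icc 1 (p - 1), ∃ j ∈ Finset.Icc 1 (q - 1),
    f = ∑ h ∈ Finset.Icc 1 j, massEntry p q (i + 1) h - ∑ h ∈ Finset.Icc 1 j, massEntry p q i h}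

/-- All the inequalities describing the image inside the generalized Birkhoff polytope. -/
def massIneqs (p q : ℕ) : Set (Matrix (Fin p) (Fin q) ℝ →ᵃ[ℝ] ℝ) :=
  massCornerIneqs p q ∪ massInteriorIneqs p q ∪ massColumnSumIneqs p q ∪ massRowSumIneqs p q

/-!
The boundary conditions force `pq · c_{ij} = i j + G_{ij}` with `G` vanishing on the boundary of the
grid. In terms of the deviation `G` the convexity inequalities are homogeneous, while the remaining
ones say that the mixed differences of `G` are at least `-1`; moreover `pq` times the mass matrix of
`c` has entries `1 + mixedDiff G i j`. So the systems for the copulas and for their mass matrices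
are the same system in `G` (`gridIneq_toGrid`, `massIneq_toMass`), and only the latter has to be
studied.

*The system describes the set.* All the masses missing from the list are bounded below by one of the
two corner masses (`mixedDiff_ge_of_feasible`).

*Minimality.* It suffices to find a point at which all inequalities are strict and, for each
inequality, a point violating that one only (`isMinimalHRepresentation_of_witnesses`). A small
multiple of `-i (p - i) j (q - j)` is strictly feasible. The other points are built from tent
functions, which have nonzero second difference at a single kink.

* For a convexity inequality, add a small tent to one row of the product of a parabola and a tent
  with another kink, and scale down (`isEssential_row`).
* For a corner, take minus a product of two tents peaked next to that corner
  (`isEssential_lowerCorner`, `isEssential_upperCorner`).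
* For the cell `(k, l)`, let row `i` be a negative multiple of the tent with kink at `l` if `i ≤ k`
  and at `l + 1` if `i > k`, where the multiples are linear in `i` on both parts. The jump of the
  kink concentrates the negative mass on that cell. The ratio of the two slopes has to satisfy four
  inequalities, and a solution exists, up to transposition, because the cell is neither
  `(1, 1)` nor `(p - 2, q - 2)` (`exists_slope_ratio`, `isEssential_cell_aux`).

The points violating only one inequality also show that the listed inequalities are pairwise
distinct, so that their number is the number of their names (`card_valid`).
-/

/-! ### Certifying minimality of an H-representation -/

theorem affineMap_lineMap_apply {E : Type*} [AddCommGroup E] [Module ℝ E] (g : E →ᵃ[ℝ] ℝ)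
    (a b : E) (t : ℝ) : g (AffineMap.lineMap a b t) = (1 - t) * g a + t * g b := by
  rw [AffineMap.apply_lineMap, AffineMap.lineMap_apply_ring]

/-- If no inequality that is tight at `z` is slack at `a`, then the segment from `a` to `z` can be
prolonged a little beyond `z` without violating any inequality. -/
theorem exists_prolongation {E : Type*} [AddCommGroup E] [Module ℝ E]
    {S : Set (E →ᵃ[ℝ] ℝ)} (hS : S.Finite) {a z : E} (hz : ∀ g ∈ S, 0 ≤ g z)
    (htight : ∀ g ∈ S, g z = 0 → g a = 0) :
    ∃ ε : ℝ, 0 < ε ∧ ∀ g ∈ S, 0 ≤ g (AffineMap.lineMap a z (1 + ε)) := by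
  have key : ∀ᶠ ε : ℝ in nhdsWithin 0 (Set.Ioi 0),
      ∀ g ∈ S, 0 ≤ g (AffineMap.lineMap a z (1 + ε)) := by
    refine (Filter.eventually_all_finite hS).2 fun g hg => ?_
    simp only [affineMap_lineMap_apply]
    rcases (hz g hg).eq_or_lt with h0 | hpos
    · simp [← h0, htight g hg h0.symm]
    · have hc : Continuous fun ε : ℝ => (1 - (1 + ε)) * g a + (1 + ε) * g z := by fun_prop
      have ht := (hc.tendsto 0).mono_left (nhdsWithin_le_nhds (s := Set.Ioi 0))
      have h1 : (0 : ℝ) < (1 - (1 + 0)) * g a + (1 + 0) * g z := by simpa using hpos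
      exact (ht.eventually (lt_mem_nhds h1)).mono fun _ h => h.le
  obtain ⟨ε, hε, hpos⟩ := (key.and self_mem_nhdsWithin).exists
  exact ⟨ε, hpos, hε⟩

/-- A system with a point `x₀` at which all inequalities are strict and, for each inequality, a
point violating that inequality alone is a minimal H-representation, and its inequalities are
pairwise distinct. Indeed the segment from `x₀` to the point violating `f k` meets the solution set
in a segment ending in the relative interior of a facet, where `f k` is the only tight inequality.
In any other H-representation some inequality is tight there but not at `x₀`, and it serves
only one `k`: the midpoint of two such end points is a relative interior point. -/
theorem isMinimalHRepresentation_of_witnesses {E ι : Type*} [AddCommGroup E] [Module ℝ E]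
    {eqs : Set (E →ᵃ[ℝ] ℝ)} (heqs : eqs.Finite) (s : Finset ι) (f : ι → E →ᵃ[ℝ] ℝ) {x₀ : E}
    (hx₀ : ∀ e ∈ eqs, e x₀ = 0) (hpos : ∀ k ∈ s, 0 < f k x₀)
    (hwit : ∀ k ∈ s, ∃ y, (∀ e ∈ eqs, e y = 0) ∧ f k y < 0 ∧ ∀ l ∈ s, l ≠ k → 0 ≤ f l y) :
    IsMinimalHRepresentation (polyhedron eqs (f '' s)) eqs (f '' s) ∧
      (f '' s).ncard = s.card := by
  have hinj : Set.InjOn f s := by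
    intro k hk l hl hkl
    by_contra hne
    obtain ⟨y, -, hy, hy'⟩ := hwit k hk
    have := hy' l hl (Ne.symm hne)
    rw [← hkl] at this
    linarith
  have hcard : (f '' s).ncard = s.card := by
    rw [hinj.ncard_image, Set.ncard_coe_finset]
  refine ⟨⟨⟨heqs, s.finite_toSet.image f, rfl⟩, ?_, ?_⟩, hcard⟩
  · rintro _ ⟨k, hk, rfl⟩
    obtain ⟨y, hy0, hyk, hy⟩ := hwit k hk
    have hsub : polyhedron eqs (f '' s) ⊆ polyhedron eqs (f '' s \ {f k}) :=
      fun x hx => ⟨hx.1, fun g hg => hx.2 g hg.1⟩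
    refine (Set.ssubset_iff_of_subset hsub).2
      ⟨y, ⟨hy0, ?_⟩, fun h => absurd (h.2 _ ⟨k, hk, rfl⟩) (not_le.2 hyk)⟩
    rintro _ ⟨⟨l, hl, rfl⟩, hne⟩
    exact hy l hl fun h => hne (by simp [h])
  · intro eqs' ineqs' hrep
    have hP : ∀ x, x ∈ polyhedron eqs (f '' s) ↔ x ∈ polyhedron eqs' ineqs' := fun x => by
      rw [← hrep.eq_polyhedron]
    have hmem₀ : x₀ ∈ polyhedron eqs' ineqs' := (hP _).1
      ⟨hx₀, by rintro _ ⟨k, hk, rfl⟩; exact (hpos k hk).le⟩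
    -- points in the relative interior of the facets
    have hz : ∀ k ∈ s, ∃ z, (∀ e ∈ eqs, e z = 0) ∧ f k z = 0 ∧ ∀ l ∈ s, l ≠ k → 0 < f l z := by
      intro k hk
      obtain ⟨y, hy0, hyk, hy⟩ := hwit k hk
      have h0 := hpos k hk
      have hd : 0 < f k x₀ - f k y := by linarith
      refine ⟨AffineMap.lineMap x₀ y (f k x₀ / (f k x₀ - f k y)), fun e he => ?_, ?_,
        fun l hl hne => ?_⟩
      · simp [hx₀ e he, hy0 e he]
      · rw [affineMap_lineMap_apply]
        field_simp
        ring
      · rw [affineMap_lineMap_apply]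
        have h1 : 0 < 1 - f k x₀ / (f k x₀ - f k y) := by
          rw [sub_pos, div_lt_one hd]
          linarith
        have h2 := mul_pos h1 (hpos l hl)
        have h3 := mul_nonneg (div_nonneg h0.le hd.le) (hy l hl hne)
        linarith
    choose! z hz0 hzk hzl using hz
    have hzP : ∀ k ∈ s, z k ∈ polyhedron eqs' ineqs' := by
      refine fun k hk => (hP _).1 ⟨hz0 k hk, ?_⟩
      rintro _ ⟨l, hl, rfl⟩
      rcases eq_or_ne l k with rfl | hne
      · exact (hzk l hl).ge
      · exact (hzl k hk l hl hne).le
    have hfacet : ∀ k ∈ s, ∃ h ∈ ineqs', h (z k) = 0 ∧ 0 < h x₀ := by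
      intro k hk
      by_contra! hcon
      obtain ⟨ε, hε, hε'⟩ := exists_prolongation hrep.finite_ineqs (hzP k hk).2
        fun g hg hg0 => le_antisymm (hcon g hg hg0) (hmem₀.2 g hg)
      have hmem : AffineMap.lineMap x₀ (z k) (1 + ε) ∈ polyhedron eqs' ineqs' := by
        refine ⟨fun e he => ?_, hε'⟩
        rw [affineMap_lineMap_apply, hmem₀.1 e he, (hzP k hk).1 e he]
        ring
      have := ((hP _).2 hmem).2 _ ⟨k, hk, rfl⟩
      rw [affineMap_lineMap_apply, hzk k hk] at this
      nlinarith [mul_pos hε (hpos k hk)]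
    choose! h hh hhz hhx using hfacet
    rw [hcard, ← Set.ncard_coe_finset]
    refine Set.ncard_le_ncard_of_injOn h hh ?_ hrep.finite_ineqs
    intro k hk l hl hkl
    by_contra hne
    set m := AffineMap.lineMap (z k) (z l) (1 / 2 : ℝ) with hm
    have hmpos : ∀ g ∈ f '' s, 0 < g m := by
      rintro _ ⟨r, hr, rfl⟩
      rw [hm, affineMap_lineMap_apply]
      rcases eq_or_ne r k with rfl | hrk
      · have := hzl l hl r hr hne
        rw [hzk r hr]
        linarith
      · have h1 := hzl k hk r hr hrk
        rcases eq_or_ne r l with rfl | hrl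
        · rw [hzk r hr]
          linarith
        · have h2 := hzl l hl r hr hrl
          linarith
    obtain ⟨ε, hε, hε'⟩ := exists_prolongation (s.finite_toSet.image f) (a := x₀)
      (fun g hg => (hmpos g hg).le) fun g hg h0 => absurd h0 (hmpos g hg).ne'
    have hmem : AffineMap.lineMap x₀ m (1 + ε) ∈ polyhedron eqs (f '' s) := by
      refine ⟨fun e he => ?_, hε'⟩
      rw [affineMap_lineMap_apply, hm, affineMap_lineMap_apply, hx₀ e he, hz0 k hk e he,
        hz0 l hl e he]
      ring
    have h1 := ((hP _).1 hmem).2 _ (hh k hk)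
    have h2 : h k (z l) = 0 := hkl ▸ hhz l hl
    rw [affineMap_lineMap_apply, hm, affineMap_lineMap_apply, hhz k hk, h2] at h1
    nlinarith [mul_pos hε (hhx k hk)]

/-! ### The inequalities in terms of the deviation from independence -/

/-- The second mixed difference of `G` on the cell with corners `(i, j)` and `(i + 1, j + 1)`. -/
def mixedDiff (G : ℕ → ℕ → ℝ) (i j : ℕ) : ℝ :=
  G i j + G (i + 1) (j + 1) - G i (j + 1) - G (i + 1) j

/-- `G` vanishes on the boundary of the grid `{0, …, p} × {0, …, q}`. -/
structure VanishesOnBoundary (p q : ℕ) (G : ℕ → ℕ → ℝ) : Prop where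
  zero_left : ∀ j ≤ q, G 0 j = 0
  top_left : ∀ j ≤ q, G p j = 0
  zero_right : ∀ i ≤ p, G i 0 = 0
  top_right : ∀ i ≤ p, G i q = 0

/-- Names of the inequalities: the bounds at the corners, supermodularity on the cell with lower
corner `(i, j)`, convexity of row `i` at `j, j + 1, j + 2`, and convexity of column `j` at
`i, i + 1, i + 2`. -/
inductive UltraIndex
  | lowerCorner
  | upperCorner
  | cell (i j : ℕ)
  | row (i j : ℕ)
  | col (i j : ℕ)
  deriving DecidableEq

namespace UltraIndex

/-- The inequalities of the description that are not redundant. -/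
def valid (p q : ℕ) : Finset UltraIndex :=
  {lowerCorner, upperCorner} ∪
    ((Finset.Icc 1 (p - 2) ×ˢ Finset.Icc 1 (q - 2)) \ {(1, 1), (p - 2, q - 2)}).image
      (fun x => cell x.1 x.2) ∪
    (Finset.Icc 1 (p - 1) ×ˢ Finset.Icc 0 (q - 2)).image (fun x => row x.1 x.2) ∪
    (Finset.Icc 0 (p - 2) ×ˢ Finset.Icc 1 (q - 1)).image (fun x => col x.1 x.2)

section

variable {p q i j : ℕ}

@[simp]
theorem lowerCorner_mem_valid : lowerCorner ∈ valid p q := by simp [valid]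

@[simp]
theorem upperCorner_mem_valid : upperCorner ∈ valid p q := by simp [valid]

theorem cell_mem_valid : cell i j ∈ valid p q ↔
    (1 ≤ i ∧ i ≤ p - 2) ∧ (1 ≤ j ∧ j ≤ q - 2) ∧ (i, j) ≠ (1, 1) ∧ (i, j) ≠ (p - 2, q - 2) := by
  simp [valid, and_assoc]

theorem row_mem_valid : row i j ∈ valid p q ↔ (1 ≤ i ∧ i ≤ p - 1) ∧ j ≤ q - 2 := by
  simp [valid]

theorem col_mem_valid : col i j ∈ valid p q ↔ i ≤ p - 2 ∧ 1 ≤ j ∧ j ≤ q - 1 := by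
  simp [valid]

end

theorem card_valid (p q : ℕ) : (valid p q).card =
    2 + ((Finset.Icc 1 (p - 2) ×ˢ Finset.Icc 1 (q - 2)) \ {(1, 1), (p - 2, q - 2)}).card +
      (p - 1) * (q - 2 + 1) + (p - 2 + 1) * (q - 1) := by
  rw [valid, Finset.card_union_of_disjoint, Finset.card_union_of_disjoint,
    Finset.card_union_of_disjoint, Finset.card_image_of_injective, Finset.card_image_of_injective,
    Finset.card_image_of_injective]
  · simp
  all_goals first
    | (rintro ⟨a, b⟩ ⟨c, d⟩ h; simpa using h)
    | (rw [Finset.disjoint_left]; intro x hx; simp at hx ⊢; try aesop)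

/-- The constant term of an inequality. -/
def constTerm : UltraIndex → ℝ
  | lowerCorner | upperCorner | cell _ _ => 1
  | row _ _ | col _ _ => 0

/-- The linear part of an inequality, as a function of the deviation `G` of `pq · c` from the
independence copula `i j`. -/
def linearPart (p q : ℕ) : UltraIndex → (ℕ → ℕ → ℝ) → ℝ
  | lowerCorner, G => G 1 1
  | upperCorner, G => G (p - 1) (q - 1)
  | cell i j, G => mixedDiff G i j
  | row i j, G => G i j + G i (j + 2) - 2 * G i (j + 1)
  | col i j, G => G i j + G (i + 2) j - 2 * G (i + 1) j

/-- The slack of an inequality at the matrix `c` with `pq · c_{ij} = i j + G_{ij}`. -/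
def slack (p q : ℕ) (k : UltraIndex) (G : ℕ → ℕ → ℝ) : ℝ := k.constTerm + k.linearPart p q G

theorem linearPart_mul (p q : ℕ) (k : UltraIndex) (ε : ℝ) (G : ℕ → ℕ → ℝ) :
    k.linearPart p q (fun i j => ε * G i j) = ε * k.linearPart p q G := by
  cases k <;> simp only [linearPart, mixedDiff] <;> ring

/-- The transposed inequality. -/
def swap : UltraIndex → UltraIndex
  | lowerCorner => lowerCorner
  | upperCorner => upperCorner
  | cell i j => cell j i
  | row i j => col j i
  | col i j => row j i

theorem swap_swap (k : UltraIndex) : k.swap.swap = k := by cases k <;> rfl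

theorem swap_mem_valid {p q : ℕ} {k : UltraIndex} (hk : k ∈ valid p q) :
    k.swap ∈ valid q p := by
  cases k <;>
    simp only [swap, lowerCorner_mem_valid, upperCorner_mem_valid, cell_mem_valid, row_mem_valid,
      col_mem_valid, ne_eq, Prod.mk.injEq] at hk ⊢ <;> tauto

theorem slack_swap (p q : ℕ) (k : UltraIndex) (G : ℕ → ℕ → ℝ) :
    k.swap.slack q p G = k.slack p q fun i j => G j i := by
  cases k <;> simp only [swap, slack, constTerm, linearPart, mixedDiff]
  ring

end UltraIndex

open UltraIndex

theorem VanishesOnBoundary.mul_left {p q : ℕ} {G : ℕ → ℕ → ℝ} (hG : VanishesOnBoundary p q G)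
    (ε : ℝ) : VanishesOnBoundary p q fun i j => ε * G i j where
  zero_left j hj := by simp [hG.zero_left j hj]
  top_left j hj := by simp [hG.top_left j hj]
  zero_right i hi := by simp [hG.zero_right i hi]
  top_right i hi := by simp [hG.top_right i hi]

/-- The feasible deviations: those of the ultramodular discrete copulas. -/
def feasibleDeviations (p q : ℕ) : Set (ℕ → ℕ → ℝ) :=
  {G | VanishesOnBoundary p q G ∧ ∀ k ∈ valid p q, 0 ≤ k.slack p q G}

/-- The inequality `k` is violated by some deviation that satisfies all the other inequalities. -/
def IsEssential (p q : ℕ) (k : UltraIndex) : Prop :=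
  ∃ G, VanishesOnBoundary p q G ∧ k.slack p q G < 0 ∧
    ∀ l ∈ valid p q, l ≠ k → 0 ≤ l.slack p q G

theorem IsEssential.swap {p q : ℕ} {k : UltraIndex} (h : IsEssential p q k) :
    IsEssential q p k.swap := by
  obtain ⟨G, hG, hk, hl⟩ := h
  refine ⟨fun i j => G j i, ⟨hG.3, hG.4, hG.1, hG.2⟩, by rwa [slack_swap], fun l hlv hne => ?_⟩
  have := hl l.swap (swap_mem_valid hlv) fun h => hne (by rw [← h, swap_swap])
  rwa [← slack_swap, swap_swap] at this

/-- The inequalities with constant term `1` hold strictly after scaling down the deviation. -/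
theorem exists_small_scale (p q : ℕ) (G : ℕ → ℕ → ℝ) :
    ∃ ε : ℝ, 0 < ε ∧ ∀ k ∈ valid p q, k.constTerm = 1 → 0 < k.slack p q fun i j => ε * G i j := by
  have key : ∀ᶠ ε : ℝ in nhdsWithin 0 (Set.Ioi 0), ∀ k ∈ (valid p q : Set UltraIndex),
      k.constTerm = 1 → 0 < k.slack p q fun i j => ε * G i j := by
    refine (Filter.eventually_all_finite (valid p q).finite_toSet).2 fun k _ => ?_
    have hc : Continuous fun ε : ℝ => 1 + ε * k.linearPart p q G := by fun_prop
    have ht := (hc.tendsto 0).mono_left (nhdsWithin_le_nhds (s := Set.Ioi 0))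
    refine (ht.eventually (lt_mem_nhds (by simp : (0 : ℝ) < 1 + 0 * _))).mono fun ε h hk => ?_
    rwa [slack, linearPart_mul, hk]
  obtain ⟨ε, hε, hpos⟩ := (key.and self_mem_nhdsWithin).exists
  exact ⟨ε, hpos, hε⟩

/-- Convexity inequalities are homogeneous, so a deviation violating only one of them can be scaled
down until the remaining inequalities hold. -/
theorem isEssential_of_linearPart {p q : ℕ} {k : UltraIndex} (hk0 : k.constTerm = 0)
    {G : ℕ → ℕ → ℝ} (hG : VanishesOnBoundary p q G) (hk : k.linearPart p q G < 0)
    (hl : ∀ l ∈ valid p q, l ≠ k → l.constTerm = 0 → 0 ≤ l.linearPart p q G) :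
    IsEssential p q k := by
  obtain ⟨ε, hε, hε'⟩ := exists_small_scale p q G
  refine ⟨_, hG.mul_left ε, ?_, fun l hlv hne => ?_⟩
  · rw [slack, hk0, linearPart_mul, zero_add]
    exact mul_neg_of_pos_of_neg hε hk
  · have h01 : l.constTerm = 1 ∨ l.constTerm = 0 := by cases l <;> simp [constTerm]
    rcases h01 with h1 | h0
    · exact (hε' l hlv h1).le
    · rw [slack, h0, linearPart_mul, zero_add]
      exact mul_nonneg hε.le (hl l hlv hne h0)

/-- The deviations `-ε i (p - i) j (q - j)` are strictly feasible for small `ε > 0`. -/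
theorem exists_strictly_feasible (p q : ℕ) : ∃ G, VanishesOnBoundary p q G ∧
    ∀ k ∈ valid p q, 0 < k.slack p q G := by
  have hG : VanishesOnBoundary p q fun i j : ℕ => -((i : ℝ) * (p - i) * (j * (q - j))) := by
    constructor <;> simp
  obtain ⟨ε, hε, hε'⟩ := exists_small_scale p q
    fun i j : ℕ => -((i : ℝ) * (p - i) * (j * (q - j)))
  refine ⟨_, hG.mul_left ε, fun k hk => ?_⟩
  cases k with
  | row i j =>
    obtain ⟨⟨h1, h2⟩, -⟩ := row_mem_valid.1 hk
    have h3 : (0 : ℝ) < i := by exact_mod_cast h1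
    have h4 : (0 : ℝ) < p - i := by
      rw [sub_pos]
      exact_mod_cast (by omega : i < p)
    rw [slack, linearPart_mul]
    simp only [linearPart, constTerm]
    push_cast
    have := mul_pos hε (mul_pos h3 h4)
    linarith
  | col i j =>
    obtain ⟨-, h1, h2⟩ := col_mem_valid.1 hk
    have h3 : (0 : ℝ) < j := by exact_mod_cast h1
    have h4 : (0 : ℝ) < q - j := by
      rw [sub_pos]
      exact_mod_cast (by omega : j < q)
    rw [slack, linearPart_mul]
    simp only [linearPart, constTerm]
    push_cast
    have := mul_pos hε (mul_pos h3 h4)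
    linarith
  | _ => exact hε' _ hk rfl

/-! ### Redundant inequalities -/

/-- The masses `1 + mixedDiff G i j` are all nonnegative: those of the first row and column
increase from the lower corner by convexity, those of the last row and column decrease towards the
upper corner, and the mass of the cell `(1, 1)`, as well as that of its mirror image, is bounded
below by the corner mass, because of one row and one column inequality. -/
theorem mixedDiff_ge_of_feasible {p q : ℕ} (hp : 3 ≤ p) (hq : 3 ≤ q) {G : ℕ → ℕ → ℝ}
    (hG : G ∈ feasibleDeviations p q) {i j : ℕ} (hi : i < p) (hj : j < q) :
    0 ≤ 1 + mixedDiff G i j := by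
  obtain ⟨hb, hs⟩ := hG
  have hrow : ∀ i j, 1 ≤ i → i ≤ p - 1 → j ≤ q - 2 →
      0 ≤ G i j + G i (j + 2) - 2 * G i (j + 1) := fun i j h1 h2 h3 => by
    simpa [slack, constTerm, linearPart] using hs _ (row_mem_valid.2 ⟨⟨h1, h2⟩, h3⟩)
  have hcol : ∀ i j, i ≤ p - 2 → 1 ≤ j → j ≤ q - 1 →
      0 ≤ G i j + G (i + 2) j - 2 * G (i + 1) j := fun i j h1 h2 h3 => by
    simpa [slack, constTerm, linearPart] using hs _ (col_mem_valid.2 ⟨h1, h2, h3⟩)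
  have hlow : 0 ≤ 1 + G 1 1 := hs _ lowerCorner_mem_valid
  have hupp : 0 ≤ 1 + G (p - 1) (q - 1) := hs _ upperCorner_mem_valid
  obtain ⟨P, rfl⟩ : ∃ P, p = P + 3 := ⟨p - 3, by omega⟩
  obtain ⟨Q, rfl⟩ : ∃ Q, q = Q + 3 := ⟨q - 3, by omega⟩
  simp only [show P + 3 - 1 = P + 2 from rfl, show P + 3 - 2 = P + 1 from rfl,
    show Q + 3 - 1 = Q + 2 from rfl, show Q + 3 - 2 = Q + 1 from rfl] at hrow hcol hupp
  obtain ⟨hb1, hb2, hb3, hb4⟩ := hb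
  -- increments along the first interior row and column
  have hfirstrow : ∀ j, j ≤ Q + 2 → G 1 1 ≤ G 1 (j + 1) - G 1 j := by
    intro j
    induction j with
    | zero => intro _; simp [hb3 1 (by omega)]
    | succ j ih =>
      intro h
      have := ih (by omega)
      have := hrow 1 j le_rfl (by omega) (by omega)
      linarith
  have hfirstcol : ∀ i, i ≤ P + 2 → G 1 1 ≤ G (i + 1) 1 - G i 1 := by
    intro i
    induction i with
    | zero => intro _; simp [hb1 1 (by omega)]
    | succ i ih =>
      intro h
      have := ih (by omega)
      have := hcol i 1 (by omega) le_rfl (by omega)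
      linarith
  -- increments along the last interior row and column, numbered backwards
  have hlastrow : ∀ d j, j + d = Q + 2 → G (P + 2) (Q + 2) ≤ G (P + 2) j - G (P + 2) (j + 1) := by
    intro d
    induction d with
    | zero =>
      rintro j rfl
      simp [hb4 (P + 2) (by omega)]
    | succ d ih =>
      intro j h
      have := ih (j + 1) (by omega)
      have := hrow (P + 2) j (by omega) le_rfl (by omega)
      linarith
  have hlastcol : ∀ d i, i + d = P + 2 → G (P + 2) (Q + 2) ≤ G i (Q + 2) - G (i + 1) (Q + 2) := by
    intro d
    induction d with
    | zero =>
      rintro i rfl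
      simp [hb2 (Q + 2) (by omega)]
    | succ d ih =>
      intro i h
      have := ih (i + 1) (by omega)
      have := hcol i (Q + 2) (by omega) (by omega) le_rfl
      linarith
  unfold mixedDiff
  rcases Nat.eq_zero_or_pos i with rfl | hi0
  · have := hfirstrow j (by omega)
    have := hb1 j (by omega)
    have := hb1 (j + 1) (by omega)
    simp only [zero_add]
    linarith
  rcases Nat.eq_zero_or_pos j with rfl | hj0
  · have := hfirstcol i (by omega)
    have := hb3 i (by omega)
    have := hb3 (i + 1) (by omega)
    simp only [zero_add]
    linarith
  rcases eq_or_ne i (P + 2) with rfl | hi2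
  · have := hlastrow (Q + 2 - j) j (by omega)
    have := hb2 j (by omega)
    have := hb2 (j + 1) (by omega)
    simp only [add_assoc, Nat.reduceAdd] at *
    linarith
  rcases eq_or_ne j (Q + 2) with rfl | hj2
  · have := hlastcol (P + 2 - i) i (by omega)
    have := hb4 i (by omega)
    have := hb4 (i + 1) (by omega)
    simp only [add_assoc, Nat.reduceAdd] at *
    linarith
  by_cases h11 : (i, j) = (1, 1)
  · obtain ⟨rfl, rfl⟩ := Prod.mk.inj h11
    have h1 := hrow 2 0 (by omega) (by omega) (by omega)
    have h2 := hcol 0 1 (by omega) (by omega) (by omega)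
    have h3 := hcol 0 2 (by omega) (by omega) (by omega)
    have h4 := hb3 2 (by omega)
    have h5 := hb1 1 (by omega)
    have h6 := hb1 2 (by omega)
    simp only [zero_add, Nat.reduceAdd] at *
    linarith
  by_cases hPQ : (i, j) = (P + 1, Q + 1)
  · obtain ⟨rfl, rfl⟩ := Prod.mk.inj hPQ
    have h1 := hrow (P + 1) (Q + 1) (by omega) (by omega) (by omega)
    have h2 := hcol (P + 1) (Q + 2) (by omega) (by omega) (by omega)
    have h3 := hcol (P + 1) (Q + 1) (by omega) (by omega) (by omega)
    have h4 := hb4 (P + 1) (by omega)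
    have h5 := hb2 (Q + 1) (by omega)
    have h6 := hb2 (Q + 2) (by omega)
    simp only [add_assoc, Nat.reduceAdd] at *
    linarith
  · have := hs (cell i j) (cell_mem_valid.2
      ⟨⟨hi0, by omega⟩, ⟨hj0, by omega⟩, h11, by simpa using hPQ⟩)
    simpa [slack, constTerm, linearPart, mixedDiff] using this

/-! ### Tent functions -/

/-- The concave piecewise linear function on `{0, …, n}` that vanishes at `0` and `n` and has its
only kink at `k`, normalized to have the integer slopes `n - k` and `-k`. -/
def tent (n k j : ℕ) : ℝ := if j ≤ k then (j : ℝ) * (n - k) else k * (n - j)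

theorem tent_of_le {n k j : ℕ} (h : j ≤ k) : tent n k j = j * (n - k) := if_pos h

theorem tent_of_ge {n k j : ℕ} (h : k ≤ j) : tent n k j = k * (n - j) := by
  rcases h.eq_or_lt with rfl | h
  · exact tent_of_le le_rfl
  · exact if_neg (by omega)

@[simp]
theorem tent_zero (n k : ℕ) : tent n k 0 = 0 := by simp [tent]

theorem tent_self {n k : ℕ} (h : k ≤ n) : tent n k n = 0 := by simp [tent_of_ge h]

theorem tent_sub_of_lt {n k j : ℕ} (h : j < k) : tent n k (j + 1) - tent n k j = n - k := by
  rw [tent_of_le h, tent_of_le h.le]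
  push_cast
  ring

theorem tent_sub_of_ge {n k j : ℕ} (h : k ≤ j) : tent n k (j + 1) - tent n k j = -k := by
  rw [tent_of_ge (by omega), tent_of_ge h]
  push_cast
  ring

/-- The second difference of a tent function vanishes away from the kink. -/
theorem tent_secondDiff_of_ne {n k j : ℕ} (h : j + 1 ≠ k) :
    tent n k j + tent n k (j + 2) - 2 * tent n k (j + 1) = 0 := by
  rcases lt_or_gt_of_ne h with h | h
  · have h1 := tent_sub_of_lt (n := n) (k := k) (j := j) (by omega)
    have h2 := tent_sub_of_lt (n := n) h
    linarith
  · have h1 := tent_sub_of_ge (n := n) (k := k) (j := j) (by omega)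
    have h2 := tent_sub_of_ge (n := n) h.le
    linarith

theorem tent_secondDiff_self (n j : ℕ) :
    tent n (j + 1) j + tent n (j + 1) (j + 2) - 2 * tent n (j + 1) (j + 1) = -n := by
  have h1 := tent_sub_of_lt (n := n) (Nat.lt_succ_self j)
  have h2 := tent_sub_of_ge (n := n) (le_refl (j + 1))
  push_cast at h1 h2
  linarith

theorem tent_secondDiff_nonpos (n k j : ℕ) :
    tent n k j + tent n k (j + 2) - 2 * tent n k (j + 1) ≤ 0 := by
  by_cases h : j + 1 = k
  · subst h
    rw [tent_secondDiff_self]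
    simp
  · exact (tent_secondDiff_of_ne h).le

theorem tent_nonneg {n k j : ℕ} (hk : k ≤ n) (hj : j ≤ n) : 0 ≤ tent n k j := by
  have hk' : (0 : ℝ) ≤ n - k := sub_nonneg.2 (by exact_mod_cast hk)
  have hj' : (0 : ℝ) ≤ n - j := sub_nonneg.2 (by exact_mod_cast hj)
  unfold tent
  split_ifs <;> positivity

theorem one_le_tent {n k j : ℕ} (hk0 : 0 < k) (hk : k < n) (hj0 : 0 < j) (hj : j < n) :
    1 ≤ tent n k j := by
  have hk0' : (1 : ℝ) ≤ k := by exact_mod_cast hk0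
  have hj0' : (1 : ℝ) ≤ j := by exact_mod_cast hj0
  have hk' : (1 : ℝ) ≤ n - k := by
    rw [le_sub_iff_add_le]
    exact_mod_cast (by omega : 1 + k ≤ n)
  have hj' : (1 : ℝ) ≤ n - j := by
    rw [le_sub_iff_add_le]
    exact_mod_cast (by omega : 1 + j ≤ n)
  unfold tent
  split_ifs <;> nlinarith

theorem tent_le_sq {n k j : ℕ} (hk : k ≤ n) (hj : j ≤ n) : tent n k j ≤ (n : ℝ) ^ 2 := by
  have hk' : (k : ℝ) ≤ n := by exact_mod_cast hk
  have hj' : (j : ℝ) ≤ n := by exact_mod_cast hj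
  have hk0 : (0 : ℝ) ≤ k := k.cast_nonneg
  have hj0 : (0 : ℝ) ≤ j := j.cast_nonneg
  unfold tent
  split_ifs <;> nlinarith

/-! ### The convexity inequalities are essential -/

/-- Away from row `i₀`, the rows are multiples of a tent with kink at some `m ≠ j₀ + 1`. Adding to
row `i₀` a small multiple of the tent with kink at `j₀ + 1` destroys its convexity there and
nowhere else; the columns stay convex because the dependence on `i` is strictly convex. -/
theorem isEssential_row {p q i₀ j₀ : ℕ} (hq : 3 ≤ q) (hk : row i₀ j₀ ∈ valid p q) :
    IsEssential p q (row i₀ j₀) := by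
  obtain ⟨⟨hi1, hi2⟩, hj⟩ := row_mem_valid.1 hk
  obtain ⟨m, hm0, hmq, hm⟩ : ∃ m, 0 < m ∧ m < q ∧ j₀ + 1 ≠ m := by
    by_cases h : j₀ = 0
    · exact ⟨2, by omega, by omega, by omega⟩
    · exact ⟨1, by omega, by omega, by omega⟩
  set t : ℝ := 1 / (q : ℝ) ^ 2 with ht
  have hq0 : (0 : ℝ) < q := by exact_mod_cast (by omega : 0 < q)
  have ht0 : 0 < t := by positivity
  have hcmp : ∀ j, 1 ≤ j → j ≤ q - 1 → t * tent q (j₀ + 1) j ≤ tent q m j := by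
    intro j h1 h2
    have h3 := tent_le_sq (n := q) (k := j₀ + 1) (j := j) (by omega) (by omega)
    have h4 := one_le_tent hm0 hmq h1 (by omega : j < q)
    refine le_trans ?_ h4
    rw [ht, one_div_mul_eq_div]
    exact div_le_one_of_le₀ h3 (by positivity)
  refine isEssential_of_linearPart (G := fun i j => -((i : ℝ) * (p - i) * tent q m j) +
    if i = i₀ then t * tent q (j₀ + 1) j else 0) rfl ⟨?_, ?_, ?_, ?_⟩ ?_ ?_
  · intro j _
    simp [show ¬ 0 = i₀ by omega]
  · intro j _
    simp [show ¬ p = i₀ by omega]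
  · intro i _
    simp
  · intro i _
    simp [tent_self hmq.le, tent_self (show j₀ + 1 ≤ q by omega)]
  · have h1 := tent_secondDiff_of_ne (n := q) hm
    have h2 := tent_secondDiff_self q j₀
    simp only [linearPart, if_true]
    have h3 := congrArg (fun x => (i₀ : ℝ) * (p - i₀) * x) h1
    have h4 := congrArg (fun x => t * x) h2
    have h5 := mul_pos ht0 hq0
    linarith
  · intro l hl hne hl0
    cases l with
    | row i j =>
      obtain ⟨⟨h1, h2⟩, h3⟩ := row_mem_valid.1 hl
      have hpi : (0 : ℝ) ≤ p - i := sub_nonneg.2 (by exact_mod_cast (by omega : i ≤ p))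
      have h4 := mul_nonneg (mul_nonneg (Nat.cast_nonneg (α := ℝ) i) hpi)
        (neg_nonneg.2 (tent_secondDiff_nonpos q m j))
      simp only [linearPart]
      split_ifs with h
      · subst h
        have h5 := tent_secondDiff_of_ne (n := q) (k := j₀ + 1) (j := j)
          fun h => hne (by rw [Nat.succ_injective h])
        have h6 := congrArg (fun x => t * x) h5
        linarith
      · linarith
    | col i j =>
      obtain ⟨h1, h2, h3⟩ := col_mem_valid.1 hl
      have h4 := hcmp j h2 h3
      have h5 := mul_nonneg ht0.le
        (tent_nonneg (n := q) (k := j₀ + 1) (j := j) (by omega) (by omega))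
      simp only [linearPart]
      push_cast
      split_ifs <;> first | omega | linarith
    | _ => simp [constTerm] at hl0

theorem isEssential_col {p q i₀ j₀ : ℕ} (hp : 3 ≤ p) (hk : col i₀ j₀ ∈ valid p q) :
    IsEssential p q (col i₀ j₀) :=
  (isEssential_row hp (swap_mem_valid hk)).swap

/-! ### The corner inequalities are essential -/

/-- The deviation `-s · tent p k i · tent q l j` satisfies all convexity inequalities. -/
theorem slack_tent_mul_tent_nonneg {p q k l : ℕ} {s : ℝ} (hs : 0 ≤ s) (hk : k ≤ p) (hl : l ≤ q)
    {x : UltraIndex} (hx : x ∈ valid p q) (hx0 : x.constTerm = 0) :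
    0 ≤ x.slack p q fun i j => -(s * (tent p k i * tent q l j)) := by
  cases x with
  | row i j =>
    obtain ⟨⟨h1, h2⟩, h3⟩ := row_mem_valid.1 hx
    have h4 := mul_nonneg (mul_nonneg hs (tent_nonneg hk (by omega : i ≤ p)))
      (neg_nonneg.2 (tent_secondDiff_nonpos q l j))
    simp only [slack, constTerm, linearPart]
    linarith
  | col i j =>
    obtain ⟨h1, h2, h3⟩ := col_mem_valid.1 hx
    have h4 := mul_nonneg (mul_nonneg hs (tent_nonneg hl (by omega : j ≤ q)))
      (neg_nonneg.2 (tent_secondDiff_nonpos p k i))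
    simp only [slack, constTerm, linearPart]
    linarith
  | _ => simp [constTerm] at hx0

theorem vanishesOnBoundary_tent_mul_tent {p q k l : ℕ} (s : ℝ) (hk : k ≤ p) (hl : l ≤ q) :
    VanishesOnBoundary p q fun i j => -(s * (tent p k i * tent q l j)) := by
  constructor <;> simp [tent_self hk, tent_self hl]

theorem mixedDiff_tent_mul_tent (p q k l : ℕ) (s : ℝ) (i j : ℕ) :
    mixedDiff (fun i j => -(s * (tent p k i * tent q l j))) i j =
      -(s * ((tent p k (i + 1) - tent p k i) * (tent q l (j + 1) - tent q l j))) := by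
  unfold mixedDiff
  ring

/-- The factor in the two corner witnesses: it makes the mass of the corner cell `1 - 2`, while the
opposite corner and the interior cells, where both tents have slopes `±1`, keep the mass
`1 - s ≥ 0`. -/
theorem exists_corner_scale {p q : ℕ} (hp : 3 ≤ p) (hq : 3 ≤ q) :
    ∃ s : ℝ, 0 ≤ s ∧ s ≤ 1 ∧ s * (((p : ℝ) - 1) * (q - 1)) = 2 := by
  have hp' : (2 : ℝ) ≤ p - 1 := by
    rw [le_sub_iff_add_le]
    exact_mod_cast hp
  have hq' : (2 : ℝ) ≤ q - 1 := by
    rw [le_sub_iff_add_le]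
    exact_mod_cast hq
  have hpos : (4 : ℝ) ≤ ((p : ℝ) - 1) * (q - 1) := by nlinarith
  refine ⟨2 / (((p : ℝ) - 1) * (q - 1)), by positivity, ?_, ?_⟩
  · rw [div_le_one (by linarith)]
    linarith
  · rw [div_mul_cancel₀ _ (by linarith)]

theorem isEssential_lowerCorner {p q : ℕ} (hp : 3 ≤ p) (hq : 3 ≤ q) :
    IsEssential p q lowerCorner := by
  obtain ⟨s, hs0, hs1, hs⟩ := exists_corner_scale hp hq
  refine ⟨_, vanishesOnBoundary_tent_mul_tent (k := 1) (l := 1) s (by omega) (by omega), ?_, ?_⟩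
  · simp only [slack, constTerm, linearPart, tent_of_le le_rfl]
    push_cast
    linarith
  · intro x hx hne
    cases x with
    | lowerCorner => exact absurd rfl hne
    | upperCorner =>
      simp only [slack, constTerm, linearPart]
      rw [tent_of_ge (by omega), tent_of_ge (by omega), Nat.cast_sub (by omega),
        Nat.cast_sub (by omega)]
      push_cast
      linarith
    | cell i j =>
      obtain ⟨⟨h1, -⟩, ⟨h2, -⟩, -⟩ := cell_mem_valid.1 hx
      simp only [slack, constTerm, linearPart]
      rw [mixedDiff_tent_mul_tent, tent_sub_of_ge h1, tent_sub_of_ge h2]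
      push_cast
      linarith
    | _ => exact slack_tent_mul_tent_nonneg hs0 (by omega) (by omega) hx rfl

theorem isEssential_upperCorner {p q : ℕ} (hp : 3 ≤ p) (hq : 3 ≤ q) :
    IsEssential p q upperCorner := by
  obtain ⟨s, hs0, hs1, hs⟩ := exists_corner_scale hp hq
  refine ⟨_, vanishesOnBoundary_tent_mul_tent (k := p - 1) (l := q - 1) s (by omega) (by omega),
    ?_, ?_⟩
  · simp only [slack, constTerm, linearPart, tent_of_le le_rfl]
    rw [Nat.cast_sub (by omega), Nat.cast_sub (by omega)]
    push_cast
    linarith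
  · intro x hx hne
    have hp1 : (p : ℝ) - (p - 1 : ℕ) = 1 := by
      rw [Nat.cast_sub (by omega)]
      push_cast
      ring
    have hq1 : (q : ℝ) - (q - 1 : ℕ) = 1 := by
      rw [Nat.cast_sub (by omega)]
      push_cast
      ring
    cases x with
    | upperCorner => exact absurd rfl hne
    | lowerCorner =>
      simp only [slack, constTerm, linearPart]
      rw [tent_of_le (by omega), tent_of_le (by omega), hp1, hq1]
      push_cast
      linarith
    | cell i j =>
      obtain ⟨⟨-, h1⟩, ⟨-, h2⟩, -⟩ := cell_mem_valid.1 hx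
      simp only [slack, constTerm, linearPart]
      rw [mixedDiff_tent_mul_tent, tent_sub_of_lt (by omega), tent_sub_of_lt (by omega), hp1, hq1]
      linarith
    | _ => exact slack_tent_mul_tent_nonneg hs0 (by omega) (by omega) hx rfl

/-! ### The supermodularity inequalities are essential -/

theorem tent_succ_le (a b j : ℕ) :
    a * tent (a + b + 1) (a + 1) j ≤ (a + 1) * tent (a + b + 1) a j := by
  have hb : (0 : ℝ) ≤ b := b.cast_nonneg
  have hj0 : (0 : ℝ) ≤ j := j.cast_nonneg
  have ha : (0 : ℝ) ≤ a := a.cast_nonneg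
  rcases Nat.lt_or_ge a j with h | h
  · rw [tent_of_ge (show a + 1 ≤ j from h), tent_of_ge h.le]
    push_cast
    linarith
  · rw [tent_of_le h, tent_of_le (show j ≤ a + 1 by omega)]
    push_cast
    nlinarith [mul_nonneg ha hj0, mul_nonneg hb hj0]

theorem tent_le_succ {a b j : ℕ} (hj : j ≤ a + b + 1) :
    b * tent (a + b + 1) a j ≤ (b + 1) * tent (a + b + 1) (a + 1) j := by
  have hb : (0 : ℝ) ≤ b := b.cast_nonneg
  have hj0 : (j : ℝ) ≤ a + b + 1 := by exact_mod_cast hj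
  have ha : (0 : ℝ) ≤ a := a.cast_nonneg
  rcases Nat.lt_or_ge a j with h | h
  · rw [tent_of_ge (show a + 1 ≤ j from h), tent_of_ge h.le]
    push_cast
    have h1 : (0 : ℝ) ≤ a + b + 1 - j := by linarith
    nlinarith [mul_nonneg ha h1, mul_nonneg hb h1]
  · rw [tent_of_le h, tent_of_le (show j ≤ a + 1 by omega)]
    push_cast
    linarith

/-- The ratio of slopes used in the witness for a cell with `a` columns before and `b` after it, and
`c` rows before and `d` after it. The first two bounds make the witness convex in the columns, the
last two make the mass of the distinguished cell the smallest one. Each of them bounds `r` from one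
side only, and each lower bound is compatible with each upper one. -/
theorem exists_slope_ratio {a b c d : ℕ} (ha : 1 ≤ a) (hb : 1 ≤ b) (hc : 1 ≤ c) (hd : 1 ≤ d)
    (hac : 2 ≤ a * c) (hbd : 2 ≤ b * d)
    (h : c * d * ((a + 1) * (b + 1)) ≤ a * b * ((c + 1) * (d + 1))) :
    ∃ r : ℝ, 0 < r ∧ (d : ℝ) * (a + 1) ≤ r * (c + 1) * a ∧ r * c * (b + 1) ≤ (d + 1) * (b : ℝ) ∧
      r * (b + 1) < d * b + r * (c * a) ∧ (a + 1 : ℝ) < d * b + r * (c * a) := by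
  have hcross : (a + 1) * (b + 1) < (a * c) * (a + 1) + (b * d) * (b + 1) := by
    by_cases hab : a = 1 ∧ b = 1
    · obtain ⟨rfl, rfl⟩ := hab
      omega
    · have h1 : a * (a + 1) ≤ a * c * (a + 1) := Nat.mul_le_mul_right _ (Nat.le_mul_of_pos_right _ hc)
      have h2 : b * (b + 1) ≤ b * d * (b + 1) :=
        Nat.mul_le_mul_right _ (Nat.le_mul_of_pos_right _ hd)
      have h3 : (a + 1) * (b + 1) < a * (a + 1) + b * (b + 1) := by
        rcases lt_trichotomy a b with hlt | rfl | hlt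
        · obtain ⟨e, rfl⟩ := Nat.exists_eq_add_of_lt hlt
          nlinarith [Nat.zero_le (e * a), Nat.zero_le (e * e)]
        · have : 2 ≤ a := by omega
          nlinarith
        · obtain ⟨e, rfl⟩ := Nat.exists_eq_add_of_lt hlt
          nlinarith [Nat.zero_le (e * b), Nat.zero_le (e * e)]
      omega
  have ha' : (1 : ℝ) ≤ a := by exact_mod_cast ha
  have hb' : (1 : ℝ) ≤ b := by exact_mod_cast hb
  have hc' : (1 : ℝ) ≤ c := by exact_mod_cast hc
  have hd' : (1 : ℝ) ≤ d := by exact_mod_cast hd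
  have hac' : (2 : ℝ) ≤ a * c := by exact_mod_cast hac
  have hbd' : (2 : ℝ) ≤ b * d := by exact_mod_cast hbd
  have h' : (c : ℝ) * d * ((a + 1) * (b + 1)) ≤ a * b * ((c + 1) * (d + 1)) := by exact_mod_cast h
  have hcross' : ((a : ℝ) + 1) * (b + 1) < (a * c) * (a + 1) + (b * d) * (b + 1) := by
    exact_mod_cast hcross
  -- two lower bounds and two upper bounds; the last one matters only if `a * c < b + 1`
  set L₁ : ℝ := d * (a + 1) / ((c + 1) * a) with hL₁
  set L₂ : ℝ := (a + 1 - d * b) / (c * a) with hL₂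
  set U₁ : ℝ := (d + 1) * b / (c * (b + 1)) with hU₁
  set U₂ : ℝ := if (c * a : ℝ) < b + 1 then d * b / (b + 1 - c * a) else U₁ + 1 with hU₂
  have hLU₁₁ : L₁ ≤ U₁ := by
    rw [hL₁, hU₁, div_le_div_iff₀ (by positivity) (by positivity)]
    linarith
  have hLU₂₁ : L₂ < U₁ := by
    rw [hL₂, hU₁, div_lt_div_iff₀ (by positivity) (by positivity)]
    have : 0 < c * ((a : ℝ) + b + 1) * (b * d - 1) := by
      have : (0 : ℝ) < b * d - 1 := by linarith
      positivity
    linarith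
  have hLU₁₂ : L₁ < U₂ := by
    rw [hU₂]
    split_ifs with hlt
    · rw [hL₁, div_lt_div_iff₀ (by positivity) (by linarith)]
      have : 0 < d * ((a : ℝ) + b + 1) * (a * c - 1) := by
        have : (0 : ℝ) < a * c - 1 := by linarith
        positivity
      linarith
    · linarith
  have hLU₂₂ : L₂ < U₂ := by
    rw [hU₂]
    split_ifs with hlt
    · rw [hL₂, div_lt_div_iff₀ (by positivity) (by linarith)]
      linarith
    · linarith
  have hL₁pos : 0 < L₁ := by positivity
  obtain ⟨r, hr₁, hr₂, hr₃, hr₄⟩ : ∃ r, L₁ ≤ r ∧ L₂ < r ∧ r ≤ U₁ ∧ r < U₂ := by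
    have h1 := le_max_left L₁ L₂
    have h2 := le_max_right L₁ L₂
    have h3 := min_le_left U₁ U₂
    have h4 := min_le_right U₁ U₂
    have h5 : L₂ < min U₁ U₂ := lt_min hLU₂₁ hLU₂₂
    have h6 : L₁ ≤ min U₁ U₂ := le_min hLU₁₁ hLU₁₂.le
    have h7 : max L₁ L₂ < U₂ := max_lt hLU₁₂ hLU₂₂
    have h8 : max L₁ L₂ ≤ U₁ := max_le hLU₁₁ hLU₂₁.le
    exact ⟨(max L₁ L₂ + min U₁ U₂) / 2, by linarith, by linarith, by linarith, by linarith⟩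
  refine ⟨r, hL₁pos.trans_le hr₁, ?_, ?_, ?_, ?_⟩
  · rw [hL₁, div_le_iff₀ (by positivity)] at hr₁
    linarith
  · rw [hU₁, le_div_iff₀ (by positivity)] at hr₃
    linarith
  · by_cases hlt : (c * a : ℝ) < b + 1
    · rw [hU₂, if_pos hlt, lt_div_iff₀ (by linarith)] at hr₄
      linarith
    · have := mul_nonneg (hL₁pos.trans_le hr₁).le (sub_nonneg.2 (not_lt.1 hlt))
      nlinarith
  · rw [hL₂, div_lt_iff₀ (by positivity)] at hr₂
    linarith

/-- The witness for the cell `(c, a)`: all rows are multiples of tents, whose kink is at `a` in the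
rows up to `c` and at `a + 1` in the later ones; the dependence on the row number is linear on
both parts. -/
def cellWitness (a b c d : ℕ) (r s : ℝ) (i j : ℕ) : ℝ :=
  if i ≤ c then -(s * (r * i * tent (a + b + 1) a j))
  else -(s * (((c : ℝ) + d + 1 - i) * tent (a + b + 1) (a + 1) j))

/-- The cell inequality in the case in which the witness with tents along the rows works; otherwise
the one with tents along the columns does. -/
theorem isEssential_cell_aux {a b c d : ℕ} (ha : 1 ≤ a) (hb : 1 ≤ b) (hc : 1 ≤ c) (hd : 1 ≤ d)
    (hac : 2 ≤ a * c) (hbd : 2 ≤ b * d)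
    (h : c * d * ((a + 1) * (b + 1)) ≤ a * b * ((c + 1) * (d + 1))) :
    IsEssential (c + d + 1) (a + b + 1) (cell c a) := by
  obtain ⟨r, hr, hr₁, hr₂, hr₃, hr₄⟩ := exists_slope_ratio ha hb hc hd hac hbd h
  have ha' : (1 : ℝ) ≤ a := by exact_mod_cast ha
  have hb' : (1 : ℝ) ≤ b := by exact_mod_cast hb
  have hc' : (1 : ℝ) ≤ c := by exact_mod_cast hc
  have hd' : (1 : ℝ) ≤ d := by exact_mod_cast hd
  -- `m` is the largest product of slopes over the other cells
  set m : ℝ := max (r * (b + 1)) (a + 1) with hm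
  have hm₁ : r * (b + 1) ≤ m := le_max_left _ _
  have hm₂ : (a : ℝ) + 1 ≤ m := le_max_right _ _
  have hm₀ : 0 < m := by linarith
  have hmlt : m < d * b + r * (c * a) := max_lt hr₃ hr₄
  set s : ℝ := 1 / m with hs
  have hs₀ : 0 < s := by positivity
  have hsm : s * m = 1 := by rw [hs, one_div_mul_cancel hm₀.ne']
  have hbound : ∀ x : ℝ, x ≤ m → 0 ≤ 1 - s * x := fun x hx => by
    have := mul_le_mul_of_nonneg_left hx hs₀.le
    linarith
  have hT : ∀ j, j ≤ a + b + 1 → 0 ≤ tent (a + b + 1) a j := fun j hj => tent_nonneg (by omega) hj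
  have hT' : ∀ j, j ≤ a + b + 1 → 0 ≤ tent (a + b + 1) (a + 1) j :=
    fun j hj => tent_nonneg (by omega) hj
  have hd_le : d ≤ r * (c + 1) := by
    refine le_of_mul_le_mul_right ?_ (by linarith : (0 : ℝ) < a + 1)
    have : 0 ≤ r * (c + 1) := by positivity
    linarith
  have hc_le : r * c ≤ d + 1 := by
    refine le_of_mul_le_mul_right ?_ (by linarith : (0 : ℝ) < b + 1)
    linarith
  refine ⟨cellWitness a b c d r s, ⟨fun j _ => ?_, fun j _ => ?_, fun i _ => ?_, fun i _ => ?_⟩,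
    ?_, ?_⟩
  · simp [cellWitness]
  · simp [cellWitness, show ¬ c + d + 1 ≤ c by omega]
  · simp [cellWitness]
  · simp [cellWitness, tent_self (show a ≤ a + b + 1 by omega),
      tent_self (show a + 1 ≤ a + b + 1 by omega)]
  · have h1 := mul_lt_mul_of_pos_left hmlt hs₀
    have h2 := tent_sub_of_ge (n := a + b + 1) (le_refl a)
    have h3 := tent_sub_of_lt (n := a + b + 1) (Nat.lt_succ_self a)
    have h4 := congrArg (fun x => s * (r * c) * x) h2
    have h5 := congrArg (fun x => s * d * x) h3
    simp only [slack, constTerm, linearPart, mixedDiff, cellWitness, le_refl, if_true,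
      show ¬ c + 1 ≤ c by omega, if_false]
    push_cast at h4 h5 ⊢
    linarith
  · intro x hx hne
    cases x with
    | lowerCorner =>
      simp only [slack, constTerm, linearPart, cellWitness, if_pos hc, tent_of_le ha]
      have := hbound _ hm₁
      push_cast
      linarith
    | upperCorner =>
      simp only [slack, constTerm, linearPart, cellWitness, Nat.add_sub_cancel]
      rw [if_neg (by omega), tent_of_ge (by omega)]
      have := hbound _ hm₂
      push_cast
      linarith
    | cell i j =>
      obtain ⟨⟨h1, h2⟩, ⟨h3, h4⟩, -⟩ := cell_mem_valid.1 hx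
      have hne' : ¬ (i = c ∧ j = a) := fun h => hne (by rw [h.1, h.2])
      simp only [slack, constTerm, linearPart, mixedDiff, cellWitness]
      rcases lt_trichotomy i c with hi | rfl | hi
      · rw [if_pos hi.le, if_pos (by omega : i + 1 ≤ c), if_pos hi.le,
          if_pos (by omega : i + 1 ≤ c)]
        rcases Nat.lt_or_ge j a with hj | hj
        · have h5 := congrArg (fun x => s * r * x) (tent_sub_of_lt (n := a + b + 1) hj)
          have h6 := hbound _ hm₁
          push_cast at h5 ⊢
          linarith
        · have h5 := congrArg (fun x => s * r * x) (tent_sub_of_ge (n := a + b + 1) hj)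
          have h6 : 0 ≤ s * r * a := by positivity
          push_cast at h5 ⊢
          linarith
      · rw [if_pos le_rfl, if_neg (by omega : ¬ i + 1 ≤ i), if_pos le_rfl,
          if_neg (by omega : ¬ i + 1 ≤ i)]
        rcases lt_or_gt_of_ne (fun h => hne' ⟨rfl, h⟩ : j ≠ a) with hj | hj
        · have h5 := congrArg (fun x => s * (r * i) * x) (tent_sub_of_lt (n := a + b + 1) hj)
          have h6 := congrArg (fun x => s * d * x)
            (tent_sub_of_lt (n := a + b + 1) (k := a + 1) (j := j) (by omega))
          have h7 := hbound (d * b - r * (i * (b + 1))) ?_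
          · push_cast at h5 h6 ⊢
            linarith
          · have := mul_le_mul_of_nonneg_right hd_le (by linarith : (0 : ℝ) ≤ b)
            linarith
        · have h5 := congrArg (fun x => s * (r * i) * x) (tent_sub_of_ge (n := a + b + 1) hj.le)
          have h6 := congrArg (fun x => s * d * x)
            (tent_sub_of_ge (n := a + b + 1) (k := a + 1) (j := j) hj)
          have h7 := hbound (r * (i * a) - d * (a + 1)) ?_
          · push_cast at h5 h6 ⊢
            linarith
          · have := mul_le_mul_of_nonneg_right hc_le (by linarith : (0 : ℝ) ≤ a)
            linarith
      · rw [if_neg (by omega), if_neg (by omega), if_neg (by omega), if_neg (by omega)]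
        rcases Nat.lt_or_ge j (a + 1) with hj | hj
        · have h5 := congrArg (fun x => s * x) (tent_sub_of_lt (n := a + b + 1) hj)
          have h6 : 0 ≤ s * b := by positivity
          push_cast at h5 ⊢
          linarith
        · have h5 := congrArg (fun x => s * x) (tent_sub_of_ge (n := a + b + 1) hj)
          have h6 := hbound _ hm₂
          push_cast at h5 ⊢
          linarith
    | row i j =>
      obtain ⟨⟨h1, h2⟩, h3⟩ := row_mem_valid.1 hx
      have hpi : (0 : ℝ) ≤ c + d + 1 - i := by
        rw [sub_nonneg]
        exact_mod_cast (by omega : i ≤ c + d + 1)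
      simp only [slack, constTerm, linearPart, cellWitness]
      split_ifs
      · have h4 := mul_nonneg (by positivity : 0 ≤ s * (r * i))
          (neg_nonneg.2 (tent_secondDiff_nonpos (a + b + 1) a j))
        linarith
      · have h4 := mul_nonneg (mul_nonneg hs₀.le hpi)
          (neg_nonneg.2 (tent_secondDiff_nonpos (a + b + 1) (a + 1) j))
        linarith
    | col i j =>
      obtain ⟨h1, h2, h3⟩ := col_mem_valid.1 hx
      have hj : j ≤ a + b + 1 := by omega
      -- only the rows `c` and `c + 1` carry kinks
      have hkink₁ : (d : ℝ) * tent (a + b + 1) (a + 1) j ≤ r * (c + 1) * tent (a + b + 1) a j := by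
        have h4 := mul_le_mul_of_nonneg_left (tent_succ_le a b j) (by positivity : (0 : ℝ) ≤ d)
        have h5 := mul_le_mul_of_nonneg_right hr₁ (hT j hj)
        refine le_of_mul_le_mul_left ?_ (by linarith : (0 : ℝ) < a)
        linarith
      have hkink₂ : r * c * tent (a + b + 1) a j ≤ (d + 1) * tent (a + b + 1) (a + 1) j := by
        have h4 := mul_le_mul_of_nonneg_left (tent_le_succ hj) (by positivity : (0 : ℝ) ≤ r * c)
        have h5 := mul_le_mul_of_nonneg_right hr₂ (hT' j hj)
        refine le_of_mul_le_mul_left ?_ (by linarith : (0 : ℝ) < b)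
        linarith
      replace hkink₁ := mul_le_mul_of_nonneg_left hkink₁ hs₀.le
      replace hkink₂ := mul_le_mul_of_nonneg_left hkink₂ hs₀.le
      simp only [slack, constTerm, linearPart, cellWitness]
      rcases Nat.lt_or_ge (i + 1) c with hi | hi
      · rw [if_pos (by omega), if_pos (by omega), if_pos (by omega)]
        push_cast
        linarith
      rcases hi.eq_or_lt with rfl | hi
      · rw [if_pos (by omega), if_neg (by omega), if_pos (by omega)]
        push_cast at *
        linarith
      rcases (Nat.lt_succ_iff.1 (Nat.succ_lt_succ_iff.2 hi)).eq_or_lt with hi | hi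
      · obtain rfl : i = c := by omega
        rw [if_pos (by omega), if_neg (by omega), if_neg (by omega)]
        push_cast
        linarith
      · rw [if_neg (by omega), if_neg (by omega), if_neg (by omega)]
        push_cast
        linarith

theorem isEssential_cell {p q i j : ℕ} (hp : 3 ≤ p) (hq : 3 ≤ q) (hk : cell i j ∈ valid p q) :
    IsEssential p q (cell i j) := by
  obtain ⟨⟨h1, h2⟩, ⟨h3, h4⟩, h5, h6⟩ := cell_mem_valid.1 hk
  obtain ⟨d, rfl⟩ : ∃ d, p = i + d + 1 := ⟨p - 1 - i, by omega⟩
  obtain ⟨b, rfl⟩ : ∃ b, q = j + b + 1 := ⟨q - 1 - j, by omega⟩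
  have hd : 1 ≤ d := by omega
  have hb : 1 ≤ b := by omega
  have two_le : ∀ {x y : ℕ}, 1 ≤ x → 1 ≤ y → ¬ (x = 1 ∧ y = 1) → 2 ≤ x * y := by
    intro x y hx hy hxy
    by_contra hlt
    exact hxy (mul_eq_one.1 (by have := Nat.mul_pos hx hy; omega : x * y = 1))
  have hac : 2 ≤ j * i := two_le h3 h1 fun h => h5 (by rw [h.1, h.2])
  have hbd : 2 ≤ b * d := two_le hb hd fun h => h6 (by rw [Prod.mk.injEq]; omega)
  -- the construction is not symmetric under transposition, but one of its two versions applies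
  rcases le_total (i * d * ((j + 1) * (b + 1))) (j * b * ((i + 1) * (d + 1))) with h | h
  · exact isEssential_cell_aux h3 hb h1 hd hac hbd h
  · exact (isEssential_cell_aux h1 hd h3 hb (by rwa [mul_comm]) (by rwa [mul_comm]) h).swap

theorem isEssential_of_mem_valid {p q : ℕ} (hp : 3 ≤ p) (hq : 3 ≤ q) {k : UltraIndex}
    (hk : k ∈ valid p q) : IsEssential p q k := by
  cases k with
  | lowerCorner => exact isEssential_lowerCorner hp hq
  | upperCorner => exact isEssential_upperCorner hp hq
  | cell i j => exact isEssential_cell hp hq hk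
  | row i j => exact isEssential_row hq hk
  | col i j => exact isEssential_col hp hk

/-! ### Copula matrices -/

/-- The matrix `c` with `pq · c_{ij} = i j + G_{ij}`. -/
noncomputable def toGrid (p q : ℕ) (G : ℕ → ℕ → ℝ) : Matrix (Fin (p + 1)) (Fin (q + 1)) ℝ :=
  Matrix.of fun i j => ((i : ℕ) * (j : ℕ) + G i j) / (p * q)

theorem gridEntry_apply {p q i j : ℕ} (hi : i ≤ p) (hj : j ≤ q)
    (c : Matrix (Fin (p + 1)) (Fin (q + 1)) ℝ) :
    gridEntry p q i j c = c ⟨i, Nat.lt_succ_of_le hi⟩ ⟨j, Nat.lt_succ_of_le hj⟩ := by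
  rw [gridEntry, dif_pos ⟨Nat.lt_succ_of_le hi, Nat.lt_succ_of_le hj⟩]
  rfl

theorem gridEntry_toGrid {p q i j : ℕ} (hi : i ≤ p) (hj : j ≤ q) (G : ℕ → ℕ → ℝ) :
    gridEntry p q i j (toGrid p q G) = (i * j + G i j) / (p * q) := by
  rw [gridEntry_apply hi hj]
  rfl

theorem exists_eq_toGrid {p q : ℕ} (hp : 3 ≤ p) (hq : 3 ≤ q)
    (c : Matrix (Fin (p + 1)) (Fin (q + 1)) ℝ) : ∃ G, c = toGrid p q G := by
  have hp0 : (p : ℝ) ≠ 0 := by exact_mod_cast (by omega : p ≠ 0)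
  have hq0 : (q : ℝ) ≠ 0 := by exact_mod_cast (by omega : q ≠ 0)
  refine ⟨fun i j => p * q * gridEntry p q i j c - i * j, ?_⟩
  ext i j
  simp only [toGrid, Matrix.of_apply,
    gridEntry_apply (Nat.le_of_lt_succ i.2) (Nat.le_of_lt_succ j.2)]
  field_simp
  ring

/-- The inequalities on copula matrices, by name. -/
noncomputable def gridIneq (p q : ℕ) :
    UltraIndex → Matrix (Fin (p + 1)) (Fin (q + 1)) ℝ →ᵃ[ℝ] ℝ
  | lowerCorner => gridEntry p q 1 1
  | upperCorner => gridEntry p q (p - 1) (q - 1)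
      - AffineMap.const ℝ _ ((((p : ℝ) - 1) * ((q : ℝ) - 1) - 1) / ((p : ℝ) * q))
  | cell i j => gridEntry p q i j + gridEntry p q (i + 1) (j + 1)
      - gridEntry p q i (j + 1) - gridEntry p q (i + 1) j
  | row i j => gridEntry p q i j + gridEntry p q i (j + 2) - (2 : ℝ) • gridEntry p q i (j + 1)
  | col i j => gridEntry p q i j + gridEntry p q (i + 2) j - (2 : ℝ) • gridEntry p q (i + 1) j

theorem ultramodularIneqs_eq_image (p q : ℕ) :
    ultramodularIneqs p q = gridIneq p q '' valid p q := by
  ext f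
  simp only [ultramodularIneqs, cornerIneqs, supermodularIneqs, rowConvexityIneqs,
    columnConvexityIneqs, Set.mem_union, Set.mem_insert_iff, Set.mem_singleton_iff,
    Set.mem_ofPred_eq, Set.mem_image, Finset.mem_coe, Finset.mem_Icc]
  constructor
  · rintro ((((rfl | rfl) | ⟨i, hi, j, hj, h1, h2, rfl⟩) | ⟨i, hi, j, hj, rfl⟩) |
      ⟨j, hj, i, hi, rfl⟩)
    · exact ⟨lowerCorner, lowerCorner_mem_valid, rfl⟩
    · exact ⟨upperCorner, upperCorner_mem_valid, rfl⟩
    · exact ⟨cell i j, cell_mem_valid.2 ⟨hi, hj, h1, h2⟩, rfl⟩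
    · exact ⟨row i j, row_mem_valid.2 ⟨hi, hj.2⟩, rfl⟩
    · exact ⟨col i j, col_mem_valid.2 ⟨hi.2, hj⟩, rfl⟩
  · rintro ⟨k, hk, rfl⟩
    cases k with
    | lowerCorner => exact Or.inl (Or.inl (Or.inl (Or.inl rfl)))
    | upperCorner => exact Or.inl (Or.inl (Or.inl (Or.inr rfl)))
    | cell i j =>
      obtain ⟨hi, hj, h1, h2⟩ := cell_mem_valid.1 hk
      exact Or.inl (Or.inl (Or.inr ⟨i, hi, j, hj, h1, h2, rfl⟩))
    | row i j =>
      obtain ⟨hi, hj⟩ := row_mem_valid.1 hk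
      exact Or.inl (Or.inr ⟨i, hi, j, ⟨j.zero_le, hj⟩, rfl⟩)
    | col i j =>
      obtain ⟨hi, hj⟩ := col_mem_valid.1 hk
      exact Or.inr ⟨j, hj, i, ⟨i.zero_le, hi⟩, rfl⟩

theorem gridIneq_toGrid {p q : ℕ} (hp : 3 ≤ p) (hq : 3 ≤ q) {k : UltraIndex}
    (hk : k ∈ valid p q) (G : ℕ → ℕ → ℝ) :
    gridIneq p q k (toGrid p q G) = k.slack p q G / (p * q) := by
  have hp0 : (p : ℝ) ≠ 0 := by exact_mod_cast (by omega : p ≠ 0)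
  have hq0 : (q : ℝ) ≠ 0 := by exact_mod_cast (by omega : q ≠ 0)
  cases k with
  | lowerCorner =>
    simp only [gridIneq, slack, constTerm, linearPart]
    rw [gridEntry_toGrid (by omega) (by omega)]
    simp
  | upperCorner =>
    simp only [gridIneq, slack, constTerm, linearPart, AffineMap.coe_sub, Pi.sub_apply,
      AffineMap.const_apply]
    rw [gridEntry_toGrid (by omega) (by omega), Nat.cast_sub (by omega), Nat.cast_sub (by omega)]
    push_cast
    ring
  | cell i j =>
    obtain ⟨⟨h1, h2⟩, ⟨h3, h4⟩, -⟩ := cell_mem_valid.1 hk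
    simp only [gridIneq, slack, constTerm, linearPart, mixedDiff, AffineMap.coe_sub,
      AffineMap.coe_add, Pi.sub_apply, Pi.add_apply]
    iterate 4 rw [gridEntry_toGrid (by omega) (by omega)]
    push_cast
    ring
  | row i j =>
    obtain ⟨⟨h1, h2⟩, h3⟩ := row_mem_valid.1 hk
    simp only [gridIneq, slack, constTerm, linearPart, AffineMap.coe_sub, AffineMap.coe_smul,
      AffineMap.coe_add, Pi.sub_apply, Pi.add_apply, Pi.smul_apply, smul_eq_mul]
    iterate 3 rw [gridEntry_toGrid (by omega) (by omega)]
    push_cast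
    ring
  | col i j =>
    obtain ⟨h1, h2, h3⟩ := col_mem_valid.1 hk
    simp only [gridIneq, slack, constTerm, linearPart, AffineMap.coe_sub, AffineMap.coe_smul,
      AffineMap.coe_add, Pi.sub_apply, Pi.add_apply, Pi.smul_apply, smul_eq_mul]
    iterate 3 rw [gridEntry_toGrid (by omega) (by omega)]
    push_cast
    ring

theorem boundaryEqs_finite (p q : ℕ) : (boundaryEqs p q).Finite := by
  have h : ∀ (n : ℕ) (g : ℕ → Matrix (Fin (p + 1)) (Fin (q + 1)) ℝ →ᵃ[ℝ] ℝ),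
      {f | ∃ j ≤ n, f = g j}.Finite := fun n g =>
    ((Set.finite_Iic n).image g).subset (by rintro _ ⟨j, hj, rfl⟩; exact ⟨j, hj, rfl⟩)
  exact (((h _ _).union (h _ _)).union (h _ _)).union (h _ _)

/-- The boundary values of `toGrid p q G` are those of a copula exactly if `G` vanishes on the
boundary. -/
theorem boundary_toGrid_iff {p q : ℕ} (hp : 3 ≤ p) (hq : 3 ≤ q) {G : ℕ → ℕ → ℝ} :
    ((∀ j ≤ q, gridEntry p q 0 j (toGrid p q G) = 0 ∧
        gridEntry p q p j (toGrid p q G) = (j : ℝ) / q) ∧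
      ∀ i ≤ p, gridEntry p q i 0 (toGrid p q G) = 0 ∧
        gridEntry p q i q (toGrid p q G) = (i : ℝ) / p) ↔ VanishesOnBoundary p q G := by
  have hp0 : (p : ℝ) ≠ 0 := by exact_mod_cast (by omega : p ≠ 0)
  have hq0 : (q : ℝ) ≠ 0 := by exact_mod_cast (by omega : q ≠ 0)
  have h1 : ∀ j ≤ q, gridEntry p q 0 j (toGrid p q G) = 0 ↔ G 0 j = 0 := fun j hj => by
    rw [gridEntry_toGrid (by omega) hj]
    simp [hp0, hq0]
  have h2 : ∀ j ≤ q, gridEntry p q p j (toGrid p q G) = (j : ℝ) / q ↔ G p j = 0 :=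
    fun j hj => by
      rw [gridEntry_toGrid le_rfl hj, div_eq_div_iff (mul_ne_zero hp0 hq0) hq0,
        show (j : ℝ) * (p * q) = p * j * q by ring, mul_left_inj' hq0]
      simp
  have h3 : ∀ i ≤ p, gridEntry p q i 0 (toGrid p q G) = 0 ↔ G i 0 = 0 := fun i hi => by
    rw [gridEntry_toGrid hi (by omega)]
    simp [hp0, hq0]
  have h4 : ∀ i ≤ p, gridEntry p q i q (toGrid p q G) = (i : ℝ) / p ↔ G i q = 0 :=
    fun i hi => by
      rw [gridEntry_toGrid hi le_rfl, div_eq_div_iff (mul_ne_zero hp0 hq0) hp0,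
        show (i : ℝ) * (p * q) = i * q * p by ring, mul_left_inj' hp0]
      simp
  constructor
  · rintro ⟨ha, hb⟩
    exact ⟨fun j hj => (h1 j hj).1 (ha j hj).1, fun j hj => (h2 j hj).1 (ha j hj).2,
      fun i hi => (h3 i hi).1 (hb i hi).1, fun i hi => (h4 i hi).1 (hb i hi).2⟩
  · rintro ⟨ha, hb, hc, hd⟩
    exact ⟨fun j hj => ⟨(h1 j hj).2 (ha j hj), (h2 j hj).2 (hb j hj)⟩,
      fun i hi => ⟨(h3 i hi).2 (hc i hi), (h4 i hi).2 (hd i hi)⟩⟩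

theorem boundaryEqs_toGrid_iff {p q : ℕ} (hp : 3 ≤ p) (hq : 3 ≤ q) {G : ℕ → ℕ → ℝ} :
    (∀ e ∈ boundaryEqs p q, e (toGrid p q G) = 0) ↔ VanishesOnBoundary p q G := by
  rw [← boundary_toGrid_iff hp hq]
  constructor
  · intro h
    refine ⟨fun j hj => ⟨h _ (Or.inl (Or.inl (Or.inl ⟨j, hj, rfl⟩))), ?_⟩,
      fun i hi => ⟨h _ (Or.inl (Or.inr ⟨i, hi, rfl⟩)), ?_⟩⟩
    · have := h _ (Or.inl (Or.inl (Or.inr ⟨j, hj, rfl⟩)))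
      simpa [sub_eq_zero] using this
    · have := h _ (Or.inr ⟨i, hi, rfl⟩)
      simpa [sub_eq_zero] using this
  · rintro ⟨h1, h2⟩ e (((⟨j, hj, rfl⟩ | ⟨j, hj, rfl⟩) | ⟨i, hi, rfl⟩) | ⟨i, hi, rfl⟩)
    · exact (h1 j hj).1
    · simp [(h1 j hj).2]
    · exact (h2 i hi).1
    · simp [(h2 i hi).2]

theorem toGrid_mem_ultramodularDiscreteCopulas_iff {p q : ℕ} (hp : 3 ≤ p) (hq : 3 ≤ q)
    {G : ℕ → ℕ → ℝ} :
    toGrid p q G ∈ ultramodularDiscreteCopulas p q ↔ G ∈ feasibleDeviations p q := by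
  have hpq : (0 : ℝ) < p * q := by
    have hp0 : (0 : ℝ) < p := by exact_mod_cast (by omega : 0 < p)
    have hq0 : (0 : ℝ) < q := by exact_mod_cast (by omega : 0 < q)
    positivity
  have hdiv : ∀ x : ℝ, 0 ≤ x / (p * q) ↔ 0 ≤ x := fun x => by rw [le_div_iff₀ hpq, zero_mul]
  -- supermodularity and the two convexity conditions in terms of `G`
  have hcell : ∀ i j, i < p → j < q →
      (0 ≤ gridEntry p q (i + 1) (j + 1) (toGrid p q G) + gridEntry p q i j (toGrid p q G)
        - gridEntry p q (i + 1) j (toGrid p q G) - gridEntry p q i (j + 1) (toGrid p q G) ↔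
      0 ≤ 1 + mixedDiff G i j) := by
    intro i j hi hj
    iterate 4 rw [gridEntry_toGrid (by omega) (by omega)]
    rw [← hdiv (1 + _), mixedDiff]
    push_cast
    ring_nf
  have hrow : ∀ i j, i ≤ p → j + 2 ≤ q →
      (2 * gridEntry p q i (j + 1) (toGrid p q G) ≤
        gridEntry p q i j (toGrid p q G) + gridEntry p q i (j + 2) (toGrid p q G) ↔
      0 ≤ (row i j).slack p q G) := by
    intro i j hi hj
    iterate 3 rw [gridEntry_toGrid (by omega) (by omega)]
    rw [← hdiv ((row i j).slack p q G), ← sub_nonneg]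
    simp only [slack, constTerm, linearPart]
    push_cast
    ring_nf
  have hcol : ∀ i j, i + 2 ≤ p → j ≤ q →
      (2 * gridEntry p q (i + 1) j (toGrid p q G) ≤
        gridEntry p q i j (toGrid p q G) + gridEntry p q (i + 2) j (toGrid p q G) ↔
      0 ≤ (col i j).slack p q G) := by
    intro i j hi hj
    iterate 3 rw [gridEntry_toGrid (by omega) (by omega)]
    rw [← hdiv ((col i j).slack p q G), ← sub_nonneg]
    simp only [slack, constTerm, linearPart]
    push_cast
    ring_nf
  constructor
  · rintro ⟨⟨hb1, hb2, hsm⟩, hconv⟩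
    have hb := (boundary_toGrid_iff hp hq).1 ⟨hb1, hb2⟩
    have hmass : ∀ i j, i < p → j < q → 0 ≤ 1 + mixedDiff G i j := fun i j hi hj =>
      (hcell i j hi hj).1 (hsm (i + 1) (Finset.mem_Icc.2 ⟨by omega, hi⟩) (j + 1)
        (Finset.mem_Icc.2 ⟨by omega, hj⟩))
    refine ⟨hb, fun k hk => ?_⟩
    cases k with
    | lowerCorner =>
      have := hmass 0 0 (by omega) (by omega)
      simpa [mixedDiff, hb.zero_left, hb.zero_right 1 (by omega), hb.zero_left 1 (by omega),
        slack, constTerm, linearPart] using this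
    | upperCorner =>
      have := hmass (p - 1) (q - 1) (by omega) (by omega)
      simpa [mixedDiff, show p - 1 + 1 = p by omega, show q - 1 + 1 = q by omega,
        hb.top_left q le_rfl, hb.top_left (q - 1) (by omega), hb.top_right (p - 1) (by omega),
        slack, constTerm, linearPart] using this
    | cell i j =>
      obtain ⟨⟨h1, h2⟩, ⟨h3, h4⟩, -⟩ := cell_mem_valid.1 hk
      exact hmass i j (by omega) (by omega)
    | row i j =>
      obtain ⟨⟨h1, h2⟩, h3⟩ := row_mem_valid.1 hk
      exact (hrow i j (by omega) (by omega)).1 (hconv i (Finset.mem_Icc.2 ⟨h1, h2⟩) (j + 1)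
        (Finset.mem_Icc.2 ⟨by omega, by omega⟩)).2
    | col i j =>
      obtain ⟨h1, h2, h3⟩ := col_mem_valid.1 hk
      exact (hcol i j (by omega) (by omega)).1 (hconv (i + 1)
        (Finset.mem_Icc.2 ⟨by omega, by omega⟩) j (Finset.mem_Icc.2 ⟨h2, h3⟩)).1
  · intro hG
    have hb := (boundary_toGrid_iff hp hq).2 hG.1
    refine ⟨⟨hb.1, hb.2, fun i hi j hj => ?_⟩, fun i hi j hj => ?_⟩
    · obtain ⟨hi1, hi2⟩ := Finset.mem_Icc.1 hi
      obtain ⟨hj1, hj2⟩ := Finset.mem_Icc.1 hj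
      obtain ⟨i, rfl⟩ := Nat.exists_eq_add_of_le' hi1
      obtain ⟨j, rfl⟩ := Nat.exists_eq_add_of_le' hj1
      exact (hcell i j hi2 hj2).2 (mixedDiff_ge_of_feasible hp hq hG hi2 hj2)
    · obtain ⟨hi1, hi2⟩ := Finset.mem_Icc.1 hi
      obtain ⟨hj1, hj2⟩ := Finset.mem_Icc.1 hj
      obtain ⟨i, rfl⟩ := Nat.exists_eq_add_of_le' hi1
      obtain ⟨j, rfl⟩ := Nat.exists_eq_add_of_le' hj1
      exact ⟨(hcol i (j + 1) (by omega) (by omega)).2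
          (hG.2 _ (col_mem_valid.2 ⟨by omega, hj1, hj2⟩)),
        (hrow (i + 1) j (by omega) (by omega)).2
          (hG.2 _ (row_mem_valid.2 ⟨⟨hi1, hi2⟩, by omega⟩))⟩

theorem ultramodularDiscreteCopulas_eq_image {p q : ℕ} (hp : 3 ≤ p) (hq : 3 ≤ q) :
    ultramodularDiscreteCopulas p q = toGrid p q '' feasibleDeviations p q := by
  ext c
  constructor
  · intro hc
    obtain ⟨G, rfl⟩ := exists_eq_toGrid hp hq c
    exact ⟨G, (toGrid_mem_ultramodularDiscreteCopulas_iff hp hq).1 hc, rfl⟩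
  · rintro ⟨G, hG, rfl⟩
    exact (toGrid_mem_ultramodularDiscreteCopulas_iff hp hq).2 hG

/-! ### Mass matrices -/

/-- The mass matrix with entries `1 + mixedDiff G i j`, that is, `pq` times the mass matrix of
`toGrid p q G`. -/
def toMass (p q : ℕ) (G : ℕ → ℕ → ℝ) : Matrix (Fin p) (Fin q) ℝ :=
  Matrix.of fun i j => 1 + mixedDiff G i j

theorem smul_massMatrix_toGrid {p q : ℕ} (hp : 3 ≤ p) (hq : 3 ≤ q) (G : ℕ → ℕ → ℝ) :
    ((p : ℝ) * q) • massMatrix (toGrid p q G) = toMass p q G := by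
  have hp0 : (p : ℝ) ≠ 0 := by exact_mod_cast (by omega : p ≠ 0)
  have hq0 : (q : ℝ) ≠ 0 := by exact_mod_cast (by omega : q ≠ 0)
  ext i j
  simp only [massMatrix, toGrid, toMass, mixedDiff, Matrix.smul_apply, Matrix.of_apply,
    Fin.val_succ, Fin.val_castSucc, smul_eq_mul]
  push_cast
  field_simp
  ring

theorem ultramodularBirkhoff_eq_image {p q : ℕ} (hp : 3 ≤ p) (hq : 3 ≤ q) :
    ultramodularBirkhoff p q = toMass p q '' feasibleDeviations p q := by
  rw [ultramodularBirkhoff, ultramodularDiscreteCopulas_eq_image hp hq, Set.image_image]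
  simp only [smul_massMatrix_toGrid hp hq]

theorem affineMap_sum_apply {E ι : Type*} [AddCommGroup E] [Module ℝ E] (s : Finset ι)
    (f : ι → E →ᵃ[ℝ] ℝ) (x : E) : (∑ i ∈ s, f i) x = ∑ i ∈ s, f i x := by
  classical
  induction s using Finset.induction_on with
  | empty => simp
  | insert a s ha ih => simp [Finset.sum_insert ha, ih]

theorem massEntry_apply {p q i j : ℕ} (hi : i < p) (hj : j < q) (x : Matrix (Fin p) (Fin q) ℝ) :
    massEntry p q (i + 1) (j + 1) x = x ⟨i, hi⟩ ⟨j, hj⟩ := by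
  rw [massEntry, dif_pos ⟨⟨Nat.le_add_left _ _, hi⟩, ⟨Nat.le_add_left _ _, hj⟩⟩]
  rfl

theorem massEntry_toMass {p q i j : ℕ} (hi : i < p) (hj : j < q) (G : ℕ → ℕ → ℝ) :
    massEntry p q (i + 1) (j + 1) (toMass p q G) = 1 + mixedDiff G i j :=
  massEntry_apply hi hj _

theorem sum_massEntry_left_toMass {p q i j : ℕ} (hi : i ≤ p) (hj : j < q) (G : ℕ → ℕ → ℝ) :
    ∑ l ∈ Finset.Icc 1 i, massEntry p q l (j + 1) (toMass p q G) =
      i + (G i (j + 1) - G i j) - (G 0 (j + 1) - G 0 j) := by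
  induction i with
  | zero => simp
  | succ i ih =>
    rw [Finset.sum_Icc_succ_top (by omega), ih (by omega), massEntry_toMass (by omega) hj,
      mixedDiff]
    push_cast
    ring

theorem sum_massEntry_right_toMass {p q i j : ℕ} (hi : i < p) (hj : j ≤ q) (G : ℕ → ℕ → ℝ) :
    ∑ h ∈ Finset.Icc 1 j, massEntry p q (i + 1) h (toMass p q G) =
      j + (G (i + 1) j - G i j) - (G (i + 1) 0 - G i 0) := by
  induction j with
  | zero => simp
  | succ j ih =>
    rw [Finset.sum_Icc_succ_top (by omega), ih (by omega), massEntry_toMass hi (by omega),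
      mixedDiff]
    push_cast
    ring

/-- The inequalities on mass matrices, by name. -/
noncomputable def massIneq (p q : ℕ) : UltraIndex → Matrix (Fin p) (Fin q) ℝ →ᵃ[ℝ] ℝ
  | lowerCorner => massEntry p q 1 1
  | upperCorner => massEntry p q p q
  | cell i j => massEntry p q (i + 1) (j + 1)
  | row i j => ∑ l ∈ Finset.Icc 1 i, massEntry p q l (j + 1 + 1)
      - ∑ l ∈ Finset.Icc 1 i, massEntry p q l (j + 1)
  | col i j => ∑ h ∈ Finset.Icc 1 j, massEntry p q (i + 1 + 1) h
      - ∑ h ∈ Finset.Icc 1 j, massEntry p q (i + 1) h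

theorem massIneqs_eq_image {p q : ℕ} (hp : 3 ≤ p) (hq : 3 ≤ q) :
    massIneqs p q = massIneq p q '' valid p q := by
  ext f
  simp only [massIneqs, massCornerIneqs, massInteriorIneqs, massColumnSumIneqs,
    massRowSumIneqs, Set.mem_union, Set.mem_insert_iff, Set.mem_singleton_iff,
    Set.mem_ofPred_eq, Set.mem_image, Finset.mem_coe, Finset.mem_Icc]
  constructor
  · rintro ((((rfl | rfl) | ⟨i, hi, j, hj, h1, h2, rfl⟩) | ⟨i, hi, j, hj, rfl⟩) |
      ⟨i, hi, j, hj, rfl⟩)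
    · exact ⟨lowerCorner, lowerCorner_mem_valid, rfl⟩
    · exact ⟨upperCorner, upperCorner_mem_valid, rfl⟩
    · exact ⟨cell i j, cell_mem_valid.2 ⟨hi, hj, h1, h2⟩, rfl⟩
    · obtain ⟨j, rfl⟩ := Nat.exists_eq_add_of_le' hj.1
      exact ⟨row i j, row_mem_valid.2 ⟨hi, by omega⟩, rfl⟩
    · obtain ⟨i, rfl⟩ := Nat.exists_eq_add_of_le' hi.1
      exact ⟨col i j, col_mem_valid.2 ⟨by omega, hj⟩, rfl⟩
  · rintro ⟨k, hk, rfl⟩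
    cases k with
    | lowerCorner => exact Or.inl (Or.inl (Or.inl (Or.inl rfl)))
    | upperCorner => exact Or.inl (Or.inl (Or.inl (Or.inr rfl)))
    | cell i j =>
      obtain ⟨hi, hj, h1, h2⟩ := cell_mem_valid.1 hk
      exact Or.inl (Or.inl (Or.inr ⟨i, hi, j, hj, h1, h2, rfl⟩))
    | row i j =>
      obtain ⟨hi, hj⟩ := row_mem_valid.1 hk
      exact Or.inl (Or.inr ⟨i, hi, j + 1, ⟨by omega, by omega⟩, rfl⟩)
    | col i j =>
      obtain ⟨hi, hj⟩ := col_mem_valid.1 hk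
      exact Or.inr ⟨i + 1, ⟨by omega, by omega⟩, j, hj, rfl⟩

theorem massIneq_toMass {p q : ℕ} (hp : 3 ≤ p) (hq : 3 ≤ q) {k : UltraIndex}
    (hk : k ∈ valid p q) {G : ℕ → ℕ → ℝ} (hG : VanishesOnBoundary p q G) :
    massIneq p q k (toMass p q G) = k.slack p q G := by
  cases k with
  | lowerCorner =>
    have h := massEntry_toMass (p := p) (q := q) (i := 0) (j := 0) (by omega) (by omega) G
    simp only [massIneq, slack, constTerm, linearPart]
    simp only [zero_add, mixedDiff] at h
    rw [h, hG.zero_left 0 (by omega), hG.zero_left 1 (by omega), hG.zero_right 1 (by omega)]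
    ring
  | upperCorner =>
    have h := massEntry_toMass (p := p) (q := q) (i := p - 1) (j := q - 1) (by omega) (by omega) G
    simp only [massIneq, slack, constTerm, linearPart]
    simp only [mixedDiff, show p - 1 + 1 = p by omega, show q - 1 + 1 = q by omega] at h
    rw [h, hG.top_left q le_rfl, hG.top_left (q - 1) (by omega), hG.top_right (p - 1) (by omega)]
    ring
  | cell i j =>
    obtain ⟨⟨h1, h2⟩, ⟨h3, h4⟩, -⟩ := cell_mem_valid.1 hk
    exact massEntry_toMass (by omega) (by omega) G
  | row i j =>
    obtain ⟨⟨h1, h2⟩, h3⟩ := row_mem_valid.1 hk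
    simp only [massIneq, AffineMap.coe_sub, Pi.sub_apply, affineMap_sum_apply]
    rw [sum_massEntry_left_toMass (by omega) (by omega),
      sum_massEntry_left_toMass (by omega) (by omega), hG.zero_left j (by omega),
      hG.zero_left (j + 1) (by omega), hG.zero_left (j + 1 + 1) (by omega)]
    simp only [slack, constTerm, linearPart]
    ring
  | col i j =>
    obtain ⟨h1, h2, h3⟩ := col_mem_valid.1 hk
    simp only [massIneq, AffineMap.coe_sub, Pi.sub_apply, affineMap_sum_apply]
    rw [sum_massEntry_right_toMass (by omega) (by omega),
      sum_massEntry_right_toMass (by omega) (by omega), hG.zero_right i (by omega),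
      hG.zero_right (i + 1) (by omega), hG.zero_right (i + 1 + 1) (by omega)]
    simp only [slack, constTerm, linearPart]
    ring

theorem marginEqs_finite (p q : ℕ) : (marginEqs p q).Finite := by
  have h : ∀ (n : ℕ) (g : ℕ → Matrix (Fin p) (Fin q) ℝ →ᵃ[ℝ] ℝ),
      {f | ∃ j ∈ Finset.Icc 1 n, f = g j}.Finite := fun n g =>
    ((Finset.Icc 1 n).finite_toSet.image g).subset
      (by rintro _ ⟨j, hj, rfl⟩; exact ⟨j, hj, rfl⟩)
  exact (h _ _).union (h _ _)

theorem marginEqs_toMass {p q : ℕ} {G : ℕ → ℕ → ℝ} (hG : VanishesOnBoundary p q G) :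
    ∀ e ∈ marginEqs p q, e (toMass p q G) = 0 := by
  rintro e (⟨i, hi, rfl⟩ | ⟨j, hj, rfl⟩)
  · obtain ⟨hi1, hi2⟩ := Finset.mem_Icc.1 hi
    obtain ⟨i, rfl⟩ := Nat.exists_eq_add_of_le' hi1
    simp only [AffineMap.coe_sub, Pi.sub_apply, affineMap_sum_apply, AffineMap.const_apply]
    rw [sum_massEntry_right_toMass hi2 le_rfl, hG.top_right i (by omega), hG.top_right _ hi2,
      hG.zero_right i (by omega), hG.zero_right _ hi2]
    ring
  · obtain ⟨hj1, hj2⟩ := Finset.mem_Icc.1 hj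
    obtain ⟨j, rfl⟩ := Nat.exists_eq_add_of_le' hj1
    simp only [AffineMap.coe_sub, Pi.sub_apply, affineMap_sum_apply, AffineMap.const_apply]
    rw [sum_massEntry_left_toMass le_rfl hj2, hG.top_left j (by omega), hG.top_left _ hj2,
      hG.zero_left j (by omega), hG.zero_left _ hj2]
    ring

/-- A matrix with the prescribed margins comes from its cumulative sums. -/
theorem exists_eq_toMass {p q : ℕ} {x : Matrix (Fin p) (Fin q) ℝ}
    (hx : ∀ e ∈ marginEqs p q, e x = 0) : ∃ G, VanishesOnBoundary p q G ∧ x = toMass p q G := by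
  have hrow : ∀ i ∈ Finset.Icc 1 p, ∑ h ∈ Finset.Icc 1 q, massEntry p q i h x = q :=
    fun i hi => by
      have := hx _ (Or.inl ⟨i, hi, rfl⟩)
      simpa [affineMap_sum_apply, sub_eq_zero] using this
  have hcol : ∀ j ∈ Finset.Icc 1 q, ∑ l ∈ Finset.Icc 1 p, massEntry p q l j x = p :=
    fun j hj => by
      have := hx _ (Or.inr ⟨j, hj, rfl⟩)
      simpa [affineMap_sum_apply, sub_eq_zero] using this
  refine ⟨fun i j => ∑ l ∈ Finset.Icc 1 i, ∑ h ∈ Finset.Icc 1 j, massEntry p q l h x - i * j,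
    ⟨fun j _ => by simp, fun j hj => ?_, fun i _ => by simp, fun i hi => ?_⟩, ?_⟩
  · rw [Finset.sum_comm, Finset.sum_congr rfl fun h hh => hcol h
      (Finset.Icc_subset_Icc le_rfl hj hh)]
    simp [mul_comm]
  · rw [Finset.sum_congr rfl fun l hl => hrow l (Finset.Icc_subset_Icc le_rfl hi hl)]
    simp
  · ext i j
    rw [toMass, Matrix.of_apply, mixedDiff, Finset.sum_Icc_succ_top (by omega),
      Finset.sum_Icc_succ_top (by omega), Finset.sum_Icc_succ_top (by omega),
      massEntry_apply i.2 j.2]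
    push_cast
    ring

theorem sum_Icc_one_eq_sum_fin (n : ℕ) (f : ℕ → ℝ) :
    ∑ h ∈ Finset.Icc 1 n, f h = ∑ h : Fin n, f (h + 1) := by
  induction n with
  | zero => simp
  | succ n ih => simp [Finset.sum_Icc_succ_top, Fin.sum_univ_castSucc, ih]

theorem ultramodularBirkhoff_subset {p q : ℕ} (hp : 3 ≤ p) (hq : 3 ≤ q) :
    ultramodularBirkhoff p q ⊆ generalizedBirkhoff p q := by
  rw [ultramodularBirkhoff_eq_image hp hq]
  rintro _ ⟨G, hG, rfl⟩
  refine ⟨fun i j => mixedDiff_ge_of_feasible hp hq hG i.2 j.2, fun i => ?_, fun j => ?_⟩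
  · have h := sum_massEntry_right_toMass i.2 (le_refl q) G
    simp only [sum_Icc_one_eq_sum_fin, massEntry_apply i.2 (Fin.is_lt _)] at h
    rw [h, hG.1.top_right _ i.2, hG.1.top_right _ i.2.le, hG.1.zero_right _ i.2,
      hG.1.zero_right _ i.2.le]
    ring
  · have h := sum_massEntry_left_toMass (le_refl p) j.2 G
    simp only [sum_Icc_one_eq_sum_fin, massEntry_apply (Fin.is_lt _) j.2] at h
    rw [h, hG.1.top_left _ j.2, hG.1.top_left _ j.2.le, hG.1.zero_left _ j.2,
      hG.1.zero_left _ j.2.le]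
    ring

/-! ### Minimality and the number of inequalities -/

theorem ultramodularDiscreteCopulas_eq_polyhedron {p q : ℕ} (hp : 3 ≤ p) (hq : 3 ≤ q) :
    ultramodularDiscreteCopulas p q =
      polyhedron (boundaryEqs p q) (gridIneq p q '' valid p q) := by
  have hpq : (0 : ℝ) < p * q := by exact_mod_cast Nat.mul_pos (by omega) (by omega)
  ext c
  obtain ⟨G, rfl⟩ := exists_eq_toGrid hp hq c
  rw [toGrid_mem_ultramodularDiscreteCopulas_iff hp hq]
  refine and_congr (boundaryEqs_toGrid_iff hp hq).symm ?_
  rw [Set.forall_mem_image]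
  refine forall₂_congr fun k hk => ?_
  rw [gridIneq_toGrid hp hq hk, le_div_iff₀ hpq, zero_mul]

theorem ultramodularBirkhoff_eq_polyhedron {p q : ℕ} (hp : 3 ≤ p) (hq : 3 ≤ q) :
    ultramodularBirkhoff p q = polyhedron (marginEqs p q) (massIneq p q '' valid p q) := by
  rw [ultramodularBirkhoff_eq_image hp hq]
  ext x
  constructor
  · rintro ⟨G, hG, rfl⟩
    refine ⟨marginEqs_toMass hG.1, Set.forall_mem_image.2 fun k hk => ?_⟩
    rw [massIneq_toMass hp hq hk hG.1]
    exact hG.2 k hk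
  · rintro ⟨hx, hx'⟩
    obtain ⟨G, hG, rfl⟩ := exists_eq_toMass hx
    refine ⟨G, ⟨hG, fun k hk => ?_⟩, rfl⟩
    rw [← massIneq_toMass hp hq hk hG]
    exact hx' _ ⟨k, hk, rfl⟩

theorem isMinimalHRepresentation_ultramodular {p q : ℕ} (hp : 3 ≤ p) (hq : 3 ≤ q) :
    IsMinimalHRepresentation (ultramodularDiscreteCopulas p q) (boundaryEqs p q)
      (ultramodularIneqs p q) ∧ (ultramodularIneqs p q).ncard = (valid p q).card := by
  have hpq : (0 : ℝ) < p * q := by exact_mod_cast Nat.mul_pos (by omega) (by omega)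
  rw [ultramodularDiscreteCopulas_eq_polyhedron hp hq, ultramodularIneqs_eq_image]
  obtain ⟨G₀, hG₀, hpos⟩ := exists_strictly_feasible p q
  refine isMinimalHRepresentation_of_witnesses (boundaryEqs_finite p q) (valid p q) (gridIneq p q)
    ((boundaryEqs_toGrid_iff hp hq).2 hG₀) (fun k hk => ?_) fun k hk => ?_
  · rw [gridIneq_toGrid hp hq hk]
    exact div_pos (hpos k hk) hpq
  · obtain ⟨G, hG, hneg, hothers⟩ := isEssential_of_mem_valid hp hq hk
    refine ⟨toGrid p q G, (boundaryEqs_toGrid_iff hp hq).2 hG, ?_, fun l hl hne => ?_⟩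
    · rw [gridIneq_toGrid hp hq hk]
      exact div_neg_of_neg_of_pos hneg hpq
    · rw [gridIneq_toGrid hp hq hl]
      exact div_nonneg (hothers l hl hne) hpq.le

theorem isMinimalHRepresentation_birkhoff {p q : ℕ} (hp : 3 ≤ p) (hq : 3 ≤ q) :
    IsMinimalHRepresentation (ultramodularBirkhoff p q) (marginEqs p q) (massIneqs p q) ∧
      (massIneqs p q).ncard = (valid p q).card := by
  rw [ultramodularBirkhoff_eq_polyhedron hp hq, massIneqs_eq_image hp hq]
  obtain ⟨G₀, hG₀, hpos⟩ := exists_strictly_feasible p q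
  refine isMinimalHRepresentation_of_witnesses (marginEqs_finite p q) (valid p q) (massIneq p q)
    (marginEqs_toMass hG₀) (fun k hk => ?_) fun k hk => ?_
  · rw [massIneq_toMass hp hq hk hG₀]
    exact hpos k hk
  · obtain ⟨G, hG, hneg, hothers⟩ := isEssential_of_mem_valid hp hq hk
    refine ⟨toMass p q G, marginEqs_toMass hG, ?_, fun l hl hne => ?_⟩
    · rwa [massIneq_toMass hp hq hk hG]
    · rw [massIneq_toMass hp hq hl hG]
      exact hothers l hl hne

/-- The cells `(1, 1)` and `(p - 2, q - 2)` are distinct unless `p = q = 3`. -/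
theorem card_valid_of_ne {p q : ℕ} (hp : 3 ≤ p) (hq : 3 ≤ q) (h : ¬ (p = 3 ∧ q = 3)) :
    (valid p q).card = (p - 2) * (q - 2) + 2 * ((p - 1) * (q - 1)) := by
  have hne : ((1, 1) : ℕ × ℕ) ≠ (p - 2, q - 2) := by
    rw [ne_eq, Prod.mk.injEq]
    omega
  rw [card_valid, Finset.card_sdiff_of_subset, Finset.card_pair hne, Finset.card_product,
    Nat.card_Icc, Nat.card_Icc]
  · have h2 : 2 ≤ (p - 2) * (q - 2) := by
      rcases Nat.lt_or_ge 3 p with h3 | h3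
      · exact Nat.mul_le_mul (by omega : 2 ≤ p - 2) (by omega : 1 ≤ q - 2)
      · exact Nat.mul_le_mul (by omega : 1 ≤ p - 2) (by omega : 2 ≤ q - 2)
    simp only [Nat.add_sub_cancel]
    rw [show q - 2 + 1 = q - 1 by omega, show p - 2 + 1 = p - 1 by omega]
    omega
  · intro x hx
    rcases Finset.mem_insert.1 hx with rfl | hx
    · simp only [Finset.mem_product, Finset.mem_Icc]
      omega
    · rw [Finset.mem_singleton.1 hx]
      simp only [Finset.mem_product, Finset.mem_Icc]
      omega

theorem card_valid_three : (valid 3 3).card = 10 := by decide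

theorem mainTheorem1 (p q : ℕ) (hp : 3 ≤ p) (hq : 3 ≤ q) :
    IsMinimalHRepresentation (ultramodularDiscreteCopulas p q)
      (boundaryEqs p q) (ultramodularIneqs p q) ∧
    ultramodularBirkhoff p q ⊆ generalizedBirkhoff p q ∧
    IsMinimalHRepresentation (ultramodularBirkhoff p q) (marginEqs p q) (massIneqs p q) ∧
    (¬ (p = 3 ∧ q = 3) →
      (ultramodularIneqs p q).ncard = (p - 2) * (q - 2) + 2 * ((p - 1) * (q - 1)) ∧
      (massIneqs p q).ncard = (p - 2) * (q - 2) + 2 * ((p - 1) * (q - 1))) ∧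
    (p = 3 ∧ q = 3 →
      (ultramodularIneqs p q).ncard = 10 ∧ (massIneqs p q).ncard = 10) := by
  obtain ⟨hmin, hcard⟩ := isMinimalHRepresentation_ultramodular hp hq
  obtain ⟨hmin', hcard'⟩ := isMinimalHRepresentation_birkhoff hp hq
  refine ⟨hmin, ultramodularBirkhoff_subset hp hq, hmin', fun h => ?_, fun h => ?_⟩
  · rw [hcard, hcard', card_valid_of_ne hp hq h]
    exact ⟨rfl, rfl⟩
  · obtain ⟨rfl, rfl⟩ := h
    rw [hcard, hcard', card_valid_three]
    exact ⟨rfl, rfl⟩
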